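/- Let $\mathbb K$ be a field, $n\ge 3$, $R=\mathbb K[x_0,\dots,x_n]$ with the standard grading, $\mathfrak m=(x_0,\dots,x_n)$. Let $f_1,\dots,f_n$ and $g_1,\dots,g_n$ be regular sequences of homogeneous polynomials in $R$, with $\deg f_i=d_i>1$ and $\deg g_i=e_i$. Put $I_X=(f_1,\dots,f_n)$, $I_Z=(g_1,\dots,g_n)$ (the ideals of zero-dimensional complete intersections $X$ and $Z$ in $\mathbb P^n$), $\alpha_X=\sum_{i=1}^n d_i$, and $I_Y=I_X:I_Z$ (the ideal of the scheme $Y$ linked to $Z$ in $X$). Suppose that $I_X\subseteq\mathfrak m I_Z$; in particular $Z\subset X$. Let $F_i=\wedge^i\big(\bigoplus_{j} R(-d_j)\big)$ and $G_i=\wedge^i\big(\bigoplus_{j} R(-e_j)\big)$ be the terms of the Koszul complexes of $f_1,\dots,f_n$ and $g_1,\dots,g_n$, with Koszul differentials $d_F$ and $d_G$. There is a graded homomorphism $\varphi:F_1\to G_1$ of degree $0$ expressing the $f_j$ through the $g_i$, i.e. $f_j=\sum_i\varphi_{ij}g_i$. For every such $\varphi$, the mapping cone of the dual $\{\wedge^i\varphi^\vee\}:G_\bullet^\vee(-\alpha_X)\to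 F_\bullet^\vee(-\alpha_X)$ of the comparison map $\{\wedge^i\varphi\}:F_\bullet\to G_\bullet$, with the summands $G_0^\vee(-\alpha_X)$ and $F_0^\vee(-\alpha_X)$ cancelled against each other, is a minimal graded free resolution of $R/I_Y$. That is, the complex $$0\to H_n\to H_{n-1}\to\cdots\to H_1\to H_0\to 0,$$ $$H_n=G_1^\vee(-\alpha_X),\qquad H_{i}=F_{n-i}^\vee(-\alpha_X)\oplus G_{n-i+1}^\vee(-\alpha_X)\quad(0\le i\le n-1),$$ (where $G_{n+1}=0$, so that $H_0=F_n^\vee(-\alpha_X)\cong R$), with differentials $(a,b)\mapsto(a\circ d_F+b\circ\wedge^{n-i+1}\varphi,\,-b\circ d_G)$ on $H_i$ (with $a=0$ if $i=n$), consists of finitely generated graded free modules and maps of degree $0$, is exact in positive homological degrees, has cokernel $R/I_Y$ in homological degree $0$, and the image of every $H_{i}\to H_{i-1}$ lies in $\mathfrak mH_{i-1}$. Explicitly, $$H_n\cong\bigoplus_{j=1}^n R(e_j-\alpha_X),\qquad H_i\cong\wedge^{n-i}\Big(\bigoplus_{j=1}^n R(d_j)\Big)(-\alpha_X)\oplus\wedge^{n-i+1}\Big(\bigoplus_{j=1}^n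 R(e_j)\Big)(-\alpha_X)\quad(0\le i\le n-1)$$ as graded modules. -/

import Mathlib

/-! Graded modules over `R = K[x_s : s ∈ σ]` (standard grading) are given by a module `M` with its
family of graded pieces `gr : ℤ → AddSubgroup M`. -/

namespace LinkageCone

open MvPolynomial

universe u v

section Gradings

variable {K : Type u} [Field K] {σ : Type v}

/-- `R_k` for an integer `k`: the homogeneous polynomials of degree `k`, and `0` if `k < 0`. -/
noncomputable def polyGr (K : Type u) [Field K] (σ : Type v) (k : ℤ) :
    AddSubgroup (MvPolynomial σ K) :=
  if 0 ≤ k then (homogeneousSubmodule σ K k.toNat).toAddSubgroup else ⊥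

/-- The irrelevant maximal ideal `𝔪`, generated by the variables. -/
noncomputable def irrelevant (K : Type u) [Field K] (σ : Type v) : Ideal (MvPolynomial σ K) :=
  Ideal.span (Set.range X)

/-- The graded pieces of `⨁_j R(-d_j)`: in degree `m`, the `j`-th coordinate has degree
`m - d_j`. -/
noncomputable def freeGr {ι : Type} (d : ι → ℕ) (m : ℤ) :
    AddSubgroup (ι → MvPolynomial σ K) :=
  AddSubgroup.pi Set.univ fun j => polyGr K σ (m - d j)

/-- The graded pieces of the `p`-th exterior power of a graded module: in degree `m`, the sums of
the elements `r • v₁ ∧ ⋯ ∧ v_p` with `r`, `v₁`, …, `v_p` homogeneous of total degree `m`. -/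
noncomputable def extGr {M : Type*} [AddCommGroup M] [Module (MvPolynomial σ K) M]
    (gr : ℤ → AddSubgroup M) (p : ℕ) (m : ℤ) : AddSubgroup (⋀[MvPolynomial σ K]^p M) :=
  AddSubgroup.closure
    {x | ∃ (k : ℤ) (s : Fin p → ℤ) (r : MvPolynomial σ K) (w : Fin p → M),
      r ∈ polyGr K σ k ∧ (∀ i, w i ∈ gr (s i)) ∧ k + ∑ i, s i = m ∧
      x = r • exteriorPower.ιMulti (MvPolynomial σ K) p w}

/-- The graded pieces of the dual `M^∨ = Hom(M, R)`: in degree `m`, the linear forms that raise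
degrees by `m`. -/
noncomputable def dualGr {M : Type*} [AddCommGroup M] [Module (MvPolynomial σ K) M]
    (gr : ℤ → AddSubgroup M) (m : ℤ) : AddSubgroup (Module.Dual (MvPolynomial σ K) M) where
  carrier := {l | ∀ k, ∀ x ∈ gr k, l x ∈ polyGr K σ (k + m)}
  zero_mem' := fun k x _ => by simp
  add_mem' := fun {a b} ha hb k x hx => by
    simpa using (polyGr K σ (k + m)).add_mem (ha k x hx) (hb k x hx)
  neg_mem' := fun {a} ha k x hx => by
    simpa using (polyGr K σ (k + m)).neg_mem (ha k x hx)

/-- The graded module `M` is isomorphic to `⨁_j R(-s_j)`: it has a basis for which the elements of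
degree `m` are those whose `j`-th coordinate has degree `m - s_j`, for all `j`. -/
def IsGradedFree {M : Type*} [AddCommGroup M] [Module (MvPolynomial σ K) M]
    (gr : ℤ → AddSubgroup M) {ι : Type} (s : ι → ℤ) : Prop :=
  ∃ b : Module.Basis ι (MvPolynomial σ K) M,
    ∀ (m : ℤ) (x : M), x ∈ gr m ↔ ∀ j, b.repr x j ∈ polyGr K σ (m - s j)

/-- The shift `M(a)`, with `M(a)_m = M_{a+m}`. -/
def shiftGr {M : Type*} [AddCommGroup M] (gr : ℤ → AddSubgroup M) (a m : ℤ) : AddSubgroup M :=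
  gr (a + m)

end Gradings

section Resolutions

variable {R : Type u} [CommRing R]

/-- The image in `C k` of the incoming map of a sequence `C 0 → C 1 → C 2 → ⋯`; it is zero for
`k = 0`. -/
def incoming {C : ℕ → ModuleCat.{u} R} (δ : ∀ k, C k →ₗ[R] C (k + 1)) :
    ∀ k, Submodule R (C k)
  | 0 => ⊥
  | k + 1 => LinearMap.range (δ k)

/-- `0 → C 0 → C 1 → ⋯ → C n → R/I → 0`, for some last map `C n → R/I`, is a minimal graded free
resolution of `R/I`; here `C k` is the term of homological degree `n - k`. -/
structure IsMinimalGradedFreeResolution {K : Type u} [Field K] {σ : Type}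
    (I : Ideal (MvPolynomial σ K)) (n : ℕ) (C : ℕ → ModuleCat.{u} (MvPolynomial σ K))
    (gr : ∀ k, ℤ → AddSubgroup (C k))
    (δ : ∀ k, C k →ₗ[MvPolynomial σ K] C (k + 1)) : Prop where
  /-- The terms are finite graded free modules. -/
  graded_free : ∀ k ≤ n, ∃ (r : ℕ) (s : Fin r → ℤ), IsGradedFree (K := K) (σ := σ) (gr k) s
  /-- The differentials are homogeneous of degree `0`. -/
  graded_map : ∀ k < n, ∀ (m : ℤ), ∀ x ∈ gr k m, δ k x ∈ gr (k + 1) m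
  /-- The sequence is exact, injectivity of the first map included. -/
  exact : ∀ k < n, LinearMap.ker (δ k) = incoming δ k
  /-- The last term maps onto `R/I`, by a map of degree `0`, with the expected kernel. -/
  augmentation : ∃ ε : C n →ₗ[MvPolynomial σ K] MvPolynomial σ K ⧸ I,
    Function.Surjective ε ∧ LinearMap.ker ε = incoming δ n ∧
    ∀ (m : ℤ), ∀ x ∈ gr n m, ∃ p ∈ polyGr K σ m, ε x = Ideal.Quotient.mk I p
  /-- The resolution is minimal: the image of every differential lies in `𝔪` times its target. -/
  minimal : ∀ k < n, LinearMap.range (δ k) ≤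
    irrelevant K σ • (⊤ : Submodule (MvPolynomial σ K) (C (k + 1)))

end Resolutions

section Koszul

variable {R : Type u} [CommRing R]

/-- The linear form `v ↦ ∑ j, f_j v_j` on `R^n`, that is, the first Koszul differential. -/
def formOf {n : ℕ} (f : Fin n → R) : (Fin n → R) →ₗ[R] R :=
  ∑ j, f j • LinearMap.proj j

/-- The Koszul differential `⋀^(p+1) R^n → ⋀^p R^n` of `f`:
`v₀ ∧ ⋯ ∧ v_p ↦ ∑ i, (-1)^i f(v_i) v₀ ∧ ⋯ (v_i omitted) ⋯ ∧ v_p`. -/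
noncomputable def koszulD {n : ℕ} (f : Fin n → R) (p : ℕ) :
    (⋀[R]^(p + 1) (Fin n → R)) →ₗ[R] (⋀[R]^p (Fin n → R)) :=
  exteriorPower.alternatingMapLinearEquiv
    (AlternatingMap.alternatizeUncurryFin
      ((formOf f).smulRight (exteriorPower.ιMulti R p (M := Fin n → R))))

end Koszul

section Cone

variable {R : Type u} [CommRing R]
  (F G : ℕ → Type u) [∀ k, AddCommGroup (F k)] [∀ k, Module R (F k)]
  [∀ k, AddCommGroup (G k)] [∀ k, Module R (G k)]

/-- The terms of the dual mapping cone of a map of complexes `F → G`, after cancelling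
`G_0^∨` against `F_0^∨`: `G_1^∨` for `k = 0`, and `F_k^∨ ⊕ G_{k+1}^∨` for `k ≥ 1`. -/
def coneTerm : ℕ → ModuleCat.{u} R
  | 0 => ModuleCat.of R (Module.Dual R (G 1))
  | k + 1 => ModuleCat.of R (Module.Dual R (F (k + 1)) × Module.Dual R (G (k + 2)))

variable {F G}

/-- The differential `(a, b) ↦ (a ∘ d_F + b ∘ ψ, - b ∘ d_G)` of the dual mapping cone of a map of
complexes `ψ : F → G` (with `a = 0` on the term `k = 0`). -/
def coneD (dF : ∀ k, F (k + 1) →ₗ[R] F k) (dG : ∀ k, G (k + 1) →ₗ[R] G k)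
    (ψ : ∀ k, F k →ₗ[R] G k) : ∀ k, coneTerm (R := R) F G k →ₗ[R] coneTerm (R := R) F G (k + 1)
  | 0 => LinearMap.prod (ψ 1).dualMap (-(dG 1).dualMap)
  | k + 1 => LinearMap.prod
      ((dF (k + 1)).dualMap ∘ₗ LinearMap.fst R _ _ + (ψ (k + 2)).dualMap ∘ₗ LinearMap.snd R _ _)
      (-((dG (k + 2)).dualMap ∘ₗ LinearMap.snd R _ _))

end Cone

/-- The grading of the dual mapping cone, with all duals shifted by `-α`: the terms are
`G_1^∨(-α)` and `F_k^∨(-α) ⊕ G_{k+1}^∨(-α)`. -/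
noncomputable def coneGr {K : Type u} [Field K] {σ : Type} {F G : ℕ → Type u}
    [∀ k, AddCommGroup (F k)] [∀ k, Module (MvPolynomial σ K) (F k)]
    [∀ k, AddCommGroup (G k)] [∀ k, Module (MvPolynomial σ K) (G k)]
    (grF : ∀ k, ℤ → AddSubgroup (F k)) (grG : ∀ k, ℤ → AddSubgroup (G k)) (α : ℤ) :
    ∀ k, ℤ → AddSubgroup (coneTerm (R := MvPolynomial σ K) F G k)
  | 0 => fun m => shiftGr (dualGr (grG 1)) (-α) m
  | k + 1 => fun m => AddSubgroup.prod (shiftGr (dualGr (grF (k + 1))) (-α) m)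
      (shiftGr (dualGr (grG (k + 2))) (-α) m)

section Linkage

variable {K : Type u} [Field K] {σ : Type} {n : ℕ}

/-- `f_1, …, f_n` is a regular sequence of homogeneous polynomials of degrees `d_1, …, d_n`. -/
structure IsCompleteIntersection (f : Fin n → MvPolynomial σ K) (d : Fin n → ℕ) : Prop where
  homogeneous : ∀ i, (f i).IsHomogeneous (d i)
  regular : RingTheory.Sequence.IsRegular (MvPolynomial σ K) (List.ofFn f)

/-- `φ : ⨁ R(-d_j) → ⨁ R(-e_j)` is a graded map of degree `0` that expresses the `f_j` through the
`g_i`, that is, `f_j = ∑ i, φ_ij g_i`. -/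
structure IsComparison (f g : Fin n → MvPolynomial σ K) (d e : Fin n → ℕ)
    (φ : (Fin n → MvPolynomial σ K) →ₗ[MvPolynomial σ K] (Fin n → MvPolynomial σ K)) : Prop where
  graded : ∀ (m : ℤ), ∀ v ∈ freeGr d m, φ v ∈ freeGr e m
  comm : (formOf g) ∘ₗ φ = formOf f

/-- The shifts of `⋀^k (⨁ R(d_j)) (-α) ⊕ ⋀^(k+1) (⨁ R(e_j)) (-α)`, whose first summand is left out
for `k = 0`: it is `⨁ R(-s)` over these `s`. -/
def linkShifts (d e : Fin n → ℕ) (α : ℤ) (k : ℕ) :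
    {S : Finset (Fin n) // 0 < k ∧ S.card = k} ⊕ {T : Finset (Fin n) // T.card = k + 1} → ℤ :=
  Sum.elim (fun S => α - ∑ j ∈ S.1, (d j : ℤ)) (fun T => α - ∑ j ∈ T.1, (e j : ℤ))

variable (K σ) in
/-- The terms of the mapping cone resolution: `(F_k)^∨ ⊕ (G_{k+1})^∨` (for `k = 0` only `G_1^∨`),
where `F` and `G` are the Koszul complexes on `f` and `g`, so `F_k = G_k = ⋀^k R^n`, ignoring
degrees. -/
noncomputable def linkTerm (n : ℕ) : ℕ → ModuleCat.{u} (MvPolynomial σ K) :=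
  coneTerm (fun k => ⋀[MvPolynomial σ K]^k (Fin n → MvPolynomial σ K))
    (fun k => ⋀[MvPolynomial σ K]^k (Fin n → MvPolynomial σ K))

variable (K σ) in
/-- The grading of the mapping cone resolution, where `F_k = ⋀^k (⨁ R(-d_j))`,
`G_k = ⋀^k (⨁ R(-e_j))`, and all duals are shifted by `-α_X = -∑ d_j`. -/
noncomputable def linkGr (d e : Fin n → ℕ) : ∀ k, ℤ → AddSubgroup (linkTerm K σ n k) :=
  coneGr (K := K) (σ := σ)
    (F := fun k => ⋀[MvPolynomial σ K]^k (Fin n → MvPolynomial σ K))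
    (G := fun k => ⋀[MvPolynomial σ K]^k (Fin n → MvPolynomial σ K))
    (fun k => extGr (freeGr d) k) (fun k => extGr (freeGr e) k) (∑ j, (d j : ℤ))

/-- The differentials of the mapping cone resolution, with the exterior powers of `φ` as the
comparison maps between the Koszul complexes on `f` and `g`. -/
noncomputable def linkD (f g : Fin n → MvPolynomial σ K)
    (φ : (Fin n → MvPolynomial σ K) →ₗ[MvPolynomial σ K] (Fin n → MvPolynomial σ K)) :
    ∀ k, linkTerm K σ n k →ₗ[MvPolynomial σ K] linkTerm K σ n (k + 1) :=
  coneD (koszulD f) (koszulD g) (fun k => exteriorPower.map k φ)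

end Linkage

end LinkageCone

/-! Wedging with a vector `v` is a homotopy from multiplication by `f(v)` to zero on the Koszul
complex. By depth sensitivity (`chain_exists_sub_mem`, `cochain_exists_sub_mem`), a regular sequence
of length `n` makes this complex acyclic and its dual exact below degree `n`. The dual cone is then
controlled by top cohomology, where the comparison is multiplication by `δ = det φ` from `R/I_Z` to
`R/I_X`. It remains to see that this map is injective and that `I_X + (δ) = I_X : I_Z`.

Both follow from homotopies. If `x δ ∈ I_X`, then `x` times the dual comparison map is zero on top
cohomology, hence null-homotopic; in degree `0`, where the comparison is the identity, this gives `x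
∈ I_Z` (`exists_koszulD_dualMap_eq_of_map`). If `z I_Z ⊆ I_X`, then `z : R/I_Z → R/I_X` lifts to `ζ
: G → F` with `ζ ∘ ⋀φ` homotopic to `z`; in degree `n` this gives `z ∈ I_X + (δ)`
(`exists_smul_eq_of_mem_colon`). The converse holds because `I_Z` kills the top cohomology of `G^∨`
(`apply_mem_colon`).

For minimality, two expressions of `f_j` through the `g_i` differ by a syzygy, whose entries lie in
`I_Z ⊆ 𝔪`; so `I_X ⊆ 𝔪 I_Z` puts the entries of every `φ` in `𝔪`. -/

namespace LinkageCone

/-! ### Free modules modulo an ideal -/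

section FreeModules

variable {R : Type*} [CommRing R] {M : Type*} [AddCommGroup M] [Module R M]

theorem mem_ideal_smul_top_iff_repr {ι : Type*} (b : Module.Basis ι R M) (J : Ideal R) (x : M) :
    x ∈ J • (⊤ : Submodule R M) ↔ ∀ i, b.repr x i ∈ J := by
  constructor
  · intro hx i
    induction hx using Submodule.smul_induction_on' with
    | smul r hr y _ => simpa using J.mul_mem_right _ hr
    | add y _ z _ hy hz => simpa using J.add_mem hy hz
  · intro h
    rw [← b.linearCombination_repr x, Finsupp.linearCombination_apply]
    exact Submodule.sum_mem _ fun i _ => Submodule.smul_mem_smul (h i) trivial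

theorem mem_ideal_smul_top_of_smul_mem [Module.Free R M] {J : Ideal R} {x : R}
    (hx : ∀ y, x * y ∈ J → y ∈ J) {a : M} (h : x • a ∈ J • (⊤ : Submodule R M)) :
    a ∈ J • (⊤ : Submodule R M) := by
  let b := Module.Free.chooseBasis R M
  rw [mem_ideal_smul_top_iff_repr b] at h ⊢
  intro i
  exact hx _ (by simpa using h i)

theorem map_mem_ideal_smul_top {N : Type*} [AddCommGroup N] [Module R N] (l : M →ₗ[R] N)
    {J : Ideal R} {a : M} (h : a ∈ J • (⊤ : Submodule R M)) : l a ∈ J • (⊤ : Submodule R N) :=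
  Submodule.smul_top_le_comap_smul_top J l h

theorem exists_smul_add_of_mem_sup_span {J : Ideal R} {x : R} {a : M}
    (h : a ∈ (J ⊔ Ideal.span {x}) • (⊤ : Submodule R M)) :
    ∃ b, ∃ j ∈ J • (⊤ : Submodule R M), a = x • b + j := by
  rw [Submodule.sup_smul, Submodule.ideal_span_singleton_smul, sup_comm] at h
  obtain ⟨y, hy, j, hj, rfl⟩ := Submodule.mem_sup.1 h
  obtain ⟨b, _, rfl⟩ := (Submodule.mem_smul_pointwise_iff_exists _ _ _).1 hy
  exact ⟨b, j, hj, rfl⟩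

end FreeModules

/-! ### Depth sensitivity -/

section Acyclicity

variable {R : Type*} [CommRing R] {C : ℕ → Type*} [∀ k, AddCommGroup (C k)] [∀ k, Module R (C k)]
  [∀ k, Module.Free R (C k)] {J : ℕ → Ideal R} {x : ℕ → R} {r : ℕ}

/-- Depth sensitivity for cochain complexes of free modules: if multiplication by each term of a
regular sequence is null-homotopic, then the cohomology vanishes below the length of the
sequence; here in degree `0`. -/
theorem cochain_zero_mem (d : ∀ k, C k →ₗ[R] C (k + 1))
    (hreg : ∀ i < r, ∀ y, x i * y ∈ J i → y ∈ J i)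
    (hom : ∀ i < r, ∃ h : ∀ k, C (k + 1) →ₗ[R] C k, (∀ a, x i • a = h 0 (d 0 a)) ∧
      ∀ k a, x i • a = d k (h k a) + h (k + 1) (d (k + 1) a))
    {i : ℕ} (hi : i < r) {a : C 0} (ha : d 0 a ∈ J i • (⊤ : Submodule R (C 1))) :
    a ∈ J i • (⊤ : Submodule R (C 0)) := by
  obtain ⟨h, h0, -⟩ := hom i hi
  refine mem_ideal_smul_top_of_smul_mem (hreg i hi) ?_
  rw [h0]
  exact map_mem_ideal_smul_top _ ha

/-- If `a` is a cocycle modulo `J i`, then `d (h a) ≡ x i • a`, so `h a` is a cocycle modulo `J (i +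
1)` one degree lower. By induction it is there a coboundary up to some `x i • b`; then `x i • (a - d
b)` lies in `J i`, and `x i` cancels. Each degree descended uses up one term of the sequence. -/
theorem cochain_exists_sub_mem (d : ∀ k, C k →ₗ[R] C (k + 1))
    (hdd : ∀ k a, d (k + 1) (d k a) = 0)
    (hreg : ∀ i < r, ∀ y, x i * y ∈ J i → y ∈ J i)
    (hJ : ∀ i < r, J (i + 1) = J i ⊔ Ideal.span {x i})
    (hom : ∀ i < r, ∃ h : ∀ k, C (k + 1) →ₗ[R] C k, (∀ a, x i • a = h 0 (d 0 a)) ∧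
      ∀ k a, x i • a = d k (h k a) + h (k + 1) (d (k + 1) a)) (k : ℕ) :
    ∀ i, k + 1 + i < r → ∀ a : C (k + 1), d (k + 1) a ∈ J i • (⊤ : Submodule R (C (k + 1 + 1))) →
      ∃ b, a - d k b ∈ J i • (⊤ : Submodule R (C (k + 1))) := by
  induction k with
  | zero =>
    intro i hi a ha
    obtain ⟨h, -, h1⟩ := hom i (by omega)
    have key : h 0 a ∈ J (i + 1) • (⊤ : Submodule R (C 0)) := by
      refine cochain_zero_mem d hreg hom (by omega) ?_
      rw [eq_sub_of_add_eq (h1 0 a).symm, hJ i (by omega), Submodule.sup_smul]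
      refine Submodule.sub_mem _ (Submodule.mem_sup_right
        (Submodule.smul_mem_smul (Ideal.mem_span_singleton_self _) trivial))
        (Submodule.mem_sup_left (map_mem_ideal_smul_top _ ha))
    rw [hJ i (by omega)] at key
    obtain ⟨b, j, hj, hb⟩ := exists_smul_add_of_mem_sup_span key
    refine ⟨b, mem_ideal_smul_top_of_smul_mem (hreg i (by omega)) ?_⟩
    have : x i • (a - d 0 b) = d 0 j + h 1 (d 1 a) := by
      rw [smul_sub, h1 0 a, hb, map_add, map_smul]
      abel
    rw [this]
    exact Submodule.add_mem _ (map_mem_ideal_smul_top _ hj) (map_mem_ideal_smul_top _ ha)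
  | succ k ih =>
    intro i hi a ha
    obtain ⟨h, -, h1⟩ := hom i (by omega)
    obtain ⟨c, key⟩ := ih (i + 1) (by omega) (h (k + 1) a) (by
      rw [eq_sub_of_add_eq (h1 (k + 1) a).symm, hJ i (by omega), Submodule.sup_smul]
      refine Submodule.sub_mem _ (Submodule.mem_sup_right
        (Submodule.smul_mem_smul (Ideal.mem_span_singleton_self _) trivial))
        (Submodule.mem_sup_left (map_mem_ideal_smul_top _ ha)))
    rw [hJ i (by omega)] at key
    obtain ⟨b, j, hj, hb⟩ := exists_smul_add_of_mem_sup_span key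
    refine ⟨b, mem_ideal_smul_top_of_smul_mem (hreg i (by omega)) ?_⟩
    have : x i • (a - d (k + 1) b) = d (k + 1) j + h (k + 1 + 1) (d (k + 1 + 1) a) := by
      rw [smul_sub, h1 (k + 1) a, eq_add_of_sub_eq hb, map_add, map_add, map_smul, hdd]
      abel
    rw [this]
    exact Submodule.add_mem _ (map_mem_ideal_smul_top _ hj) (map_mem_ideal_smul_top _ ha)

/-- Depth sensitivity for chain complexes of free modules of length `n`: if multiplication by each
term of a regular sequence of length `r` is null-homotopic, then the homology vanishes in degrees
above `n - r`. -/
theorem chain_exists_sub_mem (d : ∀ k, C (k + 1) →ₗ[R] C k)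
    (hdd : ∀ k a, d k (d (k + 1) a) = 0) {n : ℕ} (hn : ∀ k, n < k → Subsingleton (C k))
    (hreg : ∀ i < r, ∀ y, x i * y ∈ J i → y ∈ J i)
    (hJ : ∀ i < r, J (i + 1) = J i ⊔ Ideal.span {x i})
    (hom : ∀ i < r, ∃ h : ∀ k, C k →ₗ[R] C (k + 1),
      ∀ k a, x i • a = d (k + 1) (h (k + 1) a) + h k (d k a)) (m : ℕ) :
    ∀ i k, n ≤ k + m → n + i < k + 1 + r → ∀ a : C (k + 1),
      d k a ∈ J i • (⊤ : Submodule R (C k)) →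
      ∃ b, a - d (k + 1) b ∈ J i • (⊤ : Submodule R (C (k + 1))) := by
  -- Here `h` raises the degree, so the induction is on the distance to the top of the complex.
  induction m with
  | zero =>
    intro i k hk _ a _
    have := hn (k + 1) (by omega)
    exact ⟨0, by rw [Subsingleton.elim (a - _) 0]; exact Submodule.zero_mem _⟩
  | succ m ih =>
    intro i k hk hi a ha
    -- If `i ≥ r`, the numerical hypothesis gives `n < k + 1`, and the module is zero.
    by_cases hir : i < r
    swap
    · have := hn (k + 1) (by omega)
      exact ⟨0, by rw [Subsingleton.elim (a - _) 0]; exact Submodule.zero_mem _⟩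
    obtain ⟨h, h1⟩ := hom i hir
    obtain ⟨c, key⟩ := ih (i + 1) (k + 1) (by omega) (by omega) (h (k + 1) a) (by
      rw [eq_sub_of_add_eq (h1 k a).symm, hJ i hir, Submodule.sup_smul]
      refine Submodule.sub_mem _ (Submodule.mem_sup_right
        (Submodule.smul_mem_smul (Ideal.mem_span_singleton_self _) trivial))
        (Submodule.mem_sup_left (map_mem_ideal_smul_top _ ha)))
    rw [hJ i hir] at key
    obtain ⟨b, j, hj, hb⟩ := exists_smul_add_of_mem_sup_span key
    refine ⟨b, mem_ideal_smul_top_of_smul_mem (hreg i hir) ?_⟩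
    have : x i • (a - d (k + 1) b) = d (k + 1) j + h k (d k a) := by
      rw [smul_sub, h1 k a, eq_add_of_sub_eq hb, map_add, map_add, map_smul, hdd]
      abel
    rw [this]
    exact Submodule.add_mem _ (map_mem_ideal_smul_top _ hj) (map_mem_ideal_smul_top _ ha)

end Acyclicity

/-! ### The Koszul complex and its contracting homotopies -/

section KoszulComplex

open exteriorPower

variable {R : Type*} [CommRing R] {n : ℕ}

theorem formOf_apply (f v : Fin n → R) : formOf f v = ∑ j, f j * v j := by
  simp [formOf]

theorem koszulD_ιMulti (f : Fin n → R) (p : ℕ) (v : Fin (p + 1) → Fin n → R) :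
    koszulD f p (ιMulti R (p + 1) v) =
      ∑ i : Fin (p + 1), (-1) ^ (i : ℕ) • formOf f (v i) • ιMulti R p (i.removeNth v) := by
  simp [koszulD, AlternatingMap.alternatizeUncurryFin_apply]

/-- Left multiplication by a vector, `⋀^p R^n → ⋀^(p+1) R^n`. -/
noncomputable def wedge (v : Fin n → R) (p : ℕ) :
    (⋀[R]^p (Fin n → R)) →ₗ[R] (⋀[R]^(p + 1) (Fin n → R)) :=
  alternatingMapLinearEquiv ((ιMulti R (p + 1)).curryLeft v)

theorem wedge_ιMulti (v : Fin n → R) (p : ℕ) (w : Fin p → Fin n → R) :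
    wedge v p (ιMulti R p w) = ιMulti R (p + 1) (Fin.cons v w : Fin (p + 1) → Fin n → R) := by
  rw [wedge, alternatingMapLinearEquiv_apply_ιMulti]
  rfl

theorem koszulD_wedge_zero (f v : Fin n → R) (a : ⋀[R]^0 (Fin n → R)) :
    koszulD f 0 (wedge v 0 a) = formOf f v • a := by
  suffices h : koszulD f 0 ∘ₗ wedge v 0 = formOf f v • LinearMap.id from LinearMap.congr_fun h a
  apply linearMap_ext
  ext1 w
  simp [wedge_ιMulti, koszulD_ιMulti, -ιMulti_apply_coe]

/-- The first term of the alternating sum omits `v`; the others keep `v` in front, with the opposite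
sign. -/
theorem koszulD_wedge (f v : Fin n → R) (p : ℕ) (a : ⋀[R]^(p + 1) (Fin n → R)) :
    koszulD f (p + 1) (wedge v (p + 1) a) = formOf f v • a - wedge v p (koszulD f p a) := by
  suffices h : koszulD f (p + 1) ∘ₗ wedge v (p + 1) =
      formOf f v • LinearMap.id - wedge v p ∘ₗ koszulD f p from LinearMap.congr_fun h a
  apply linearMap_ext
  ext1 w
  simp only [LinearMap.compAlternatingMap_apply, LinearMap.comp_apply, LinearMap.sub_apply,
    LinearMap.smul_apply, LinearMap.id_apply, wedge_ιMulti, koszulD_ιMulti, map_sum,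
    map_zsmul, map_smul]
  rw [Fin.sum_univ_succ, sub_eq_add_neg, ← Finset.sum_neg_distrib]
  congr 1
  · simp [-ιMulti_apply_coe]
  · refine Finset.sum_congr rfl fun i _ => ?_
    have : (i.succ.removeNth (Fin.cons v w : Fin (p + 1 + 1) → Fin n → R)) =
        (Fin.cons v (i.removeNth w) : Fin (p + 1) → Fin n → R) := by
      funext j
      refine Fin.cases ?_ (fun j => ?_) j <;> simp [Fin.removeNth]
    rw [this]
    simp only [Fin.cons_succ, Fin.val_succ, pow_succ]
    simp [-ιMulti_apply_coe]

/-- The products `v ∧ b` span, and `d d (v ∧ b) = f(v) d b - (f(v) d b - v ∧ d d b)` vanishes by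
induction on the degree. -/
theorem koszulD_koszulD (f : Fin n → R) (p : ℕ) (a : ⋀[R]^(p + 1 + 1) (Fin n → R)) :
    koszulD f p (koszulD f (p + 1) a) = 0 := by
  suffices h : ∀ v, koszulD f p ∘ₗ koszulD f (p + 1) ∘ₗ wedge v (p + 1) = 0 by
    have h' : koszulD f p ∘ₗ koszulD f (p + 1) = 0 := by
      apply linearMap_ext
      ext1 w
      have := LinearMap.congr_fun (h (w 0)) (ιMulti R (p + 1) (Fin.tail w))
      simpa [wedge_ιMulti, -ιMulti_apply_coe] using this
    exact LinearMap.congr_fun h' a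
  clear a
  induction p with
  | zero =>
    intro v
    ext1
    ext1 w
    simp [koszulD_wedge, koszulD_wedge_zero, koszulD_ιMulti, smul_smul, mul_comm,
      -ιMulti_apply_coe]
  | succ p ih =>
    intro v
    ext1
    ext1 w
    have : w = Fin.cons (w 0) (Fin.tail w) := (Fin.cons_self_tail w).symm
    have h2 := LinearMap.congr_fun (ih (w 0)) (ιMulti R (p + 1) (Fin.tail w))
    simp only [LinearMap.comp_apply, wedge_ιMulti, Fin.cons_self_tail, LinearMap.zero_apply] at h2
    simp [koszulD_wedge, h2, -ιMulti_apply_coe]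

theorem koszulD_map {f g : Fin n → R} {φ : (Fin n → R) →ₗ[R] (Fin n → R)}
    (h : formOf g ∘ₗ φ = formOf f) (p : ℕ) (a : ⋀[R]^(p + 1) (Fin n → R)) :
    koszulD g p (exteriorPower.map (p + 1) φ a) = exteriorPower.map p φ (koszulD f p a) := by
  suffices h : koszulD g p ∘ₗ exteriorPower.map (p + 1) φ =
      exteriorPower.map p φ ∘ₗ koszulD f p from LinearMap.congr_fun h a
  apply linearMap_ext
  ext1 w
  simp only [LinearMap.compAlternatingMap_apply, LinearMap.comp_apply, map_apply_ιMulti,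
    koszulD_ιMulti, map_sum, map_zsmul, map_smul, ← h]
  rfl

theorem subsingleton_exteriorPower {p : ℕ} (hp : n < p) :
    Subsingleton (⋀[R]^p (Fin n → R)) := by
  have : IsEmpty (Set.powersetCard (Fin n) p) := by
    constructor
    rintro ⟨s, hs⟩
    have h1 : s.card = p := hs
    have := s.card_le_univ
    simp at this
    omega
  exact ((Pi.basisFun R (Fin n)).exteriorPower p).repr.toEquiv.subsingleton

theorem smul_eq_koszulD (f v : Fin n → R) (k : ℕ) (a : ⋀[R]^(k + 1) (Fin n → R)) :
    formOf f v • a = koszulD f (k + 1) (wedge v (k + 1) a) + wedge v k (koszulD f k a) := by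
  rw [koszulD_wedge]; abel

theorem smul_eq_dualMap (f v : Fin n → R) (k : ℕ)
    (a : Module.Dual R (⋀[R]^(k + 1) (Fin n → R))) :
    formOf f v • a = (koszulD f k).dualMap ((wedge v k).dualMap a) +
      (wedge v (k + 1)).dualMap ((koszulD f (k + 1)).dualMap a) := by
  refine LinearMap.ext fun y => ?_
  have := congrArg a (smul_eq_koszulD f v k y)
  rw [map_smul, map_add] at this
  exact this.trans (add_comm _ _)

end KoszulComplex

/-! ### Exactness of the Koszul complex of a regular sequence and of its dual -/

section Regular

open RingTheory.Sequence

variable {R : Type*} [CommRing R] {n : ℕ} {f : Fin n → R}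

/-- The `i`-th term of a finite sequence, padded by zeros. -/
def padded (f : Fin n → R) (i : ℕ) : R := if h : i < n then f ⟨i, h⟩ else 0

theorem formOf_single (f : Fin n → R) (i : ℕ) (hi : i < n) :
    formOf f (Pi.single ⟨i, hi⟩ 1) = padded f i := by
  simp [formOf_apply, padded, hi, Pi.single_apply]

theorem mem_take_of_padded_mul_mem (hf : IsWeaklyRegular R (List.ofFn f)) (i : ℕ) (hi : i < n)
    (y : R) (h : padded f i * y ∈ Ideal.ofList ((List.ofFn f).take i)) :
    y ∈ Ideal.ofList ((List.ofFn f).take i) := by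
  have := (isWeaklyRegular_iff _ _).1 hf i (by simpa using hi)
  rw [isSMulRegular_quotient_iff_mem_of_smul_mem] at this
  simpa using this y (by simpa [padded, hi] using h)

theorem ofList_take_succ (f : Fin n → R) (i : ℕ) (hi : i < n) :
    Ideal.ofList ((List.ofFn f).take (i + 1)) =
      Ideal.ofList ((List.ofFn f).take i) ⊔ Ideal.span {padded f i} := by
  rw [List.take_succ_eq_append_getElem (by simpa using hi), Ideal.ofList_append,
    Ideal.ofList_singleton]
  simp [padded, hi]

theorem exists_koszulD_eq (hf : IsWeaklyRegular R (List.ofFn f)) (k : ℕ)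
    (a : ⋀[R]^(k + 1) (Fin n → R)) (ha : koszulD f k a = 0) : ∃ b, koszulD f (k + 1) b = a := by
  -- The ideals `J i` come from initial segments of `f`; since `J 0 = 0`, the case `i = 0` is
  -- exactness itself.
  obtain ⟨b, hb⟩ := chain_exists_sub_mem (R := R) (C := fun k => ⋀[R]^k (Fin n → R))
    (J := fun i => Ideal.ofList ((List.ofFn f).take i)) (x := padded f) (r := n) (koszulD f)
    (koszulD_koszulD f) (n := n) (fun k hk => subsingleton_exteriorPower hk)
    (mem_take_of_padded_mul_mem hf) (ofList_take_succ f)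
    (fun i hi => ⟨fun k => wedge (Pi.single ⟨i, hi⟩ 1) k, fun k a => by
      rw [← formOf_single f i hi]; exact smul_eq_koszulD f _ k a⟩) n 0 k (by omega) (by omega) a
    (by rw [ha]; exact Submodule.zero_mem _)
  exact ⟨b, (sub_eq_zero.1 (by simpa using hb)).symm⟩

theorem dual_hom (f : Fin n → R) (i : ℕ) (hi : i < n) :
    ∃ h : ∀ k, Module.Dual R (⋀[R]^(k + 1) (Fin n → R)) →ₗ[R] Module.Dual R (⋀[R]^k (Fin n → R)),
      (∀ a, padded f i • a = h 0 ((koszulD f 0).dualMap a)) ∧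
      ∀ k a, padded f i • a = (koszulD f k).dualMap (h k a) +
        h (k + 1) ((koszulD f (k + 1)).dualMap a) := by
  refine ⟨fun k => (wedge (Pi.single ⟨i, hi⟩ 1) k).dualMap, fun a => ?_, fun k a => ?_⟩
  · refine LinearMap.ext fun y => ?_
    simp [koszulD_wedge_zero, formOf_single]
  · rw [← formOf_single f i hi]
    exact smul_eq_dualMap f _ k a

theorem eq_zero_of_koszulD_dualMap_eq_zero (hf : IsWeaklyRegular R (List.ofFn f)) (hn : 0 < n)
    (a : Module.Dual R (⋀[R]^0 (Fin n → R))) (ha : (koszulD f 0).dualMap a = 0) : a = 0 := by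
  have := cochain_zero_mem (R := R) (C := fun k => Module.Dual R (⋀[R]^k (Fin n → R)))
    (J := fun i => Ideal.ofList ((List.ofFn f).take i)) (x := padded f) (r := n)
    (fun k => (koszulD f k).dualMap) (mem_take_of_padded_mul_mem hf) (dual_hom f) (i := 0) hn
    (a := a) (by rw [ha]; exact Submodule.zero_mem _)
  simpa using this

theorem exists_koszulD_dualMap_eq (hf : IsWeaklyRegular R (List.ofFn f)) (k : ℕ) (hk : k + 1 < n)
    (a : Module.Dual R (⋀[R]^(k + 1) (Fin n → R))) (ha : (koszulD f (k + 1)).dualMap a = 0) :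
    ∃ b, (koszulD f k).dualMap b = a := by
  obtain ⟨b, hb⟩ := cochain_exists_sub_mem (R := R)
    (C := fun k => Module.Dual R (⋀[R]^k (Fin n → R)))
    (J := fun i => Ideal.ofList ((List.ofFn f).take i)) (x := padded f) (r := n)
    (fun k => (koszulD f k).dualMap)
    (fun k a => LinearMap.ext fun y => by simp [koszulD_koszulD])
    (mem_take_of_padded_mul_mem hf) (ofList_take_succ f) (dual_hom f) k 0 (by omega) a
    (by rw [ha]; exact Submodule.zero_mem _)
  exact ⟨b, (sub_eq_zero.1 (by simpa using hb)).symm⟩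

end Regular

end LinkageCone

namespace LinkageCone

universe u

section FreeModules

variable {R : Type*} [CommRing R]

theorem dual_mem_ideal_smul_top {M : Type*} [AddCommGroup M] [Module R M] [Module.Free R M]
    [Module.Finite R M] {J : Ideal R} {l : Module.Dual R M} (h : ∀ y, l y ∈ J) :
    l ∈ J • (⊤ : Submodule R (Module.Dual R M)) := by
  classical
  let b := Module.Free.chooseBasis R M
  rw [mem_ideal_smul_top_iff_repr b.dualBasis]
  intro i
  rw [b.dualBasis_repr]
  exact h _

theorem apply_mem_of_mem_ideal_smul_top {M : Type*} [AddCommGroup M] [Module R M] {J : Ideal R}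
    {y : M} (h : y ∈ J • (⊤ : Submodule R M)) (l : Module.Dual R M) : l y ∈ J := by
  simpa using map_mem_ideal_smul_top l h

theorem exists_comp_eq_of_forall_mem_range {P M N : Type*} [AddCommGroup P] [Module R P]
    [Module.Projective R P] [AddCommGroup M] [Module R M] [AddCommGroup N] [Module R N]
    (B : M →ₗ[R] N) (A : P →ₗ[R] N) (h : ∀ p, ∃ m, B m = A p) :
    ∃ C : P →ₗ[R] M, ∀ p, B (C p) = A p := by
  obtain ⟨C, hC⟩ := Module.projective_lifting_property B.rangeRestrict
    (A.codRestrict (LinearMap.range B) h) B.surjective_rangeRestrict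
  exact ⟨C, fun p => congrArg Subtype.val (LinearMap.congr_fun hC p)⟩

end FreeModules

/-! ### Construction of homotopies -/

section Homotopy

variable {R : Type*} [CommRing R]

/-- A multiple of a map from a complex of projectives to an acyclic complex is null-homotopic if
its last component is a boundary; here is the resulting identity in degree `0`. -/
theorem exists_smul_eq_of_top_mem_range {C D : ℕ → Type*} [∀ k, AddCommGroup (C k)]
    [∀ k, Module R (C k)] [∀ k, AddCommGroup (D k)] [∀ k, Module R (D k)]
    [∀ k, Module.Projective R (C k)] (dC : ∀ k, C k →ₗ[R] C (k + 1))
    (dD : ∀ k, D k →ₗ[R] D (k + 1)) (ψ : ∀ k, C k →ₗ[R] D k)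
    (hC : ∀ k c, dC (k + 1) (dC k c) = 0) (hψ : ∀ k c, dD k (ψ k c) = ψ (k + 1) (dC k c))
    {m : ℕ} (hD0 : ∀ y, dD 0 y = 0 → y = 0)
    (hD : ∀ k < m, ∀ y, dD (k + 1) y = 0 → ∃ z, dD k z = y) (x : R)
    (hx : ∀ c : C (m + 1), ∃ z, dD m z = x • ψ (m + 1) c) :
    ∃ h : C 1 →ₗ[R] D 0, ∀ c, x • ψ 0 c = h (dC 0 c) := by
  -- Descending induction on `k = m - j`: the cocycle `x • ψ - h ∘ dC` in one degree is a
  -- coboundary, and projectivity lifts it to the component of the homotopy one degree lower.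
  have key : ∀ j k, k + j = m → ∃ h : C (k + 1) →ₗ[R] D k,
      ∀ c, dD k (x • ψ k c - h (dC k c)) = 0 := by
    intro j
    induction j with
    | zero =>
      rintro k rfl
      obtain ⟨h, hh⟩ := exists_comp_eq_of_forall_mem_range (dD k) (x • ψ (k + 1)) hx
      exact ⟨h, fun c => by rw [map_sub, hh, map_smul, hψ]; simp⟩
    | succ j ih =>
      intro k hk
      obtain ⟨h, hh⟩ := ih (k + 1) (by omega)
      obtain ⟨h', hh'⟩ := exists_comp_eq_of_forall_mem_range (dD k)
        (x • ψ (k + 1) - h ∘ₗ dC (k + 1)) fun c => hD k (by omega) _ (hh c)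
      exact ⟨h', fun c => by rw [map_sub, hh', map_smul, hψ]; simp [hC]⟩
  obtain ⟨h, hh⟩ := key m 0 (by omega)
  exact ⟨h, fun c => sub_eq_zero.1 (hD0 _ (hh c))⟩

/-- Let `ψ : F → G` be a map from a complex of projectives to a complex of projectives, with `F`
acyclic. If `z` on `F 0` factors through `G 0`, compatibly with the augmentations, then `z` on `F`
factors through `ψ` up to homotopy. -/
theorem exists_lift_homotopy {F G : ℕ → Type*} [∀ k, AddCommGroup (F k)]
    [∀ k, Module R (F k)] [∀ k, AddCommGroup (G k)] [∀ k, Module R (G k)]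
    [∀ k, Module.Projective R (F k)] [∀ k, Module.Projective R (G k)]
    (dF : ∀ k, F (k + 1) →ₗ[R] F k) (dG : ∀ k, G (k + 1) →ₗ[R] G k) (ψ : ∀ k, F k →ₗ[R] G k)
    (hdF : ∀ k y, dF k (dF (k + 1) y) = 0) (hdG : ∀ k y, dG k (dG (k + 1) y) = 0)
    (hψ : ∀ k y, dG k (ψ (k + 1) y) = ψ k (dF k y))
    (hF : ∀ k y, dF k y = 0 → ∃ w, dF (k + 1) w = y) (z : R) (θ : G 0 →ₗ[R] F 0)
    (hθ : ∀ y, θ (ψ 0 y) = z • y) (hθr : ∀ y, ∃ w, dF 0 w = θ (dG 0 y)) (k : ℕ) :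
    ∃ (ζ : G (k + 1) →ₗ[R] F (k + 1)) (h : F k →ₗ[R] F (k + 1)),
      (∀ y, dF k (ζ (dG (k + 1) y)) = 0) ∧
      ∀ y, dF k (ζ (ψ (k + 1) y) - z • y - h (dF k y)) = 0 := by
  -- The two conditions say that `ζ ∘ dG` and `ζ ∘ ψ - z - h ∘ dF` have values in cycles, which is
  -- what the next lifts need. The homotopy starts at `0` because `θ ∘ ψ 0` is exactly `z`.
  induction k with
  | zero =>
    obtain ⟨ζ, hζ⟩ := exists_comp_eq_of_forall_mem_range (dF 0) (θ ∘ₗ dG 0) hθr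
    refine ⟨ζ, 0, fun y => ?_, fun y => ?_⟩
    · rw [hζ]; simp [hdG]
    · rw [map_sub, map_sub, hζ]; simp [hψ, hθ]
  | succ k ih =>
    obtain ⟨ζ, h, h1, h2⟩ := ih
    obtain ⟨ζ', hζ'⟩ := exists_comp_eq_of_forall_mem_range (dF (k + 1)) (ζ ∘ₗ dG (k + 1))
      fun y => hF k _ (h1 y)
    obtain ⟨h', hh'⟩ := exists_comp_eq_of_forall_mem_range (dF (k + 1))
      (ζ ∘ₗ ψ (k + 1) - z • LinearMap.id - h ∘ₗ dF k) fun y => hF k _ (h2 y)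
    refine ⟨ζ', h', fun y => ?_, fun y => ?_⟩
    · rw [hζ']; simp [hdG]
    · rw [map_sub, map_sub, hζ', hh']; simp [hψ, hdF]

end Homotopy

/-! ### Exactness of the dual mapping cone -/

section ConeExact

variable {R : Type u} [CommRing R] {F G : ℕ → Type u} [∀ k, AddCommGroup (F k)]
  [∀ k, Module R (F k)] [∀ k, AddCommGroup (G k)] [∀ k, Module R (G k)]

/-- `coneTerm` becomes a product only once `k` is split into cases; this and the next three lemmas
are the resulting componentwise forms. -/
theorem coneD_zero_eq_zero_iff {dF : ∀ k, F (k + 1) →ₗ[R] F k} {dG : ∀ k, G (k + 1) →ₗ[R] G k}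
    {ψ : ∀ k, F k →ₗ[R] G k} {b : Module.Dual R (G 1)} :
    coneD dF dG ψ 0 b = 0 ↔ (ψ 1).dualMap b = 0 ∧ -(dG 1).dualMap b = 0 :=
  Prod.ext_iff

theorem coneD_succ_eq_zero_iff {dF : ∀ k, F (k + 1) →ₗ[R] F k} {dG : ∀ k, G (k + 1) →ₗ[R] G k}
    {ψ : ∀ k, F k →ₗ[R] G k} {k : ℕ}
    {a : Module.Dual R (F (k + 1)) × Module.Dual R (G (k + 2))} :
    coneD dF dG ψ (k + 1) a = 0 ↔
      (dF (k + 1)).dualMap a.1 + (ψ (k + 2)).dualMap a.2 = 0 ∧ -(dG (k + 2)).dualMap a.2 = 0 :=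
  Prod.ext_iff

theorem exists_coneD_zero_eq_iff {dF : ∀ k, F (k + 1) →ₗ[R] F k} {dG : ∀ k, G (k + 1) →ₗ[R] G k}
    {ψ : ∀ k, F k →ₗ[R] G k} {a : Module.Dual R (F 1) × Module.Dual R (G 2)} :
    (∃ y, coneD dF dG ψ 0 y = a) ↔
      ∃ b, (ψ 1).dualMap b = a.1 ∧ -(dG 1).dualMap b = a.2 :=
  exists_congr fun _ => Prod.ext_iff

theorem exists_coneD_succ_eq_iff {dF : ∀ k, F (k + 1) →ₗ[R] F k} {dG : ∀ k, G (k + 1) →ₗ[R] G k}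
    {ψ : ∀ k, F k →ₗ[R] G k} {k : ℕ}
    {a : Module.Dual R (F (k + 2)) × Module.Dual R (G (k + 3))} :
    (∃ y, coneD dF dG ψ (k + 1) y = a) ↔
      ∃ c b, (dF (k + 1)).dualMap c + (ψ (k + 2)).dualMap b = a.1 ∧
        -(dG (k + 2)).dualMap b = a.2 :=
  (exists_congr fun _ => Prod.ext_iff).trans
    (Prod.exists (α := Module.Dual R (F (k + 1))) (β := Module.Dual R (G (k + 2))))

/-- The dual mapping cone of `ψ : F → G` is exact below degree `n` if the duals of `F` and `G` are
and `ψ` is injective on the cohomology of the duals in degree `n`. -/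
theorem ker_coneD_eq_incoming (dF : ∀ k, F (k + 1) →ₗ[R] F k) (dG : ∀ k, G (k + 1) →ₗ[R] G k)
    (ψ : ∀ k, F k →ₗ[R] G k) (hdF : ∀ k y, dF k (dF (k + 1) y) = 0)
    (hdG : ∀ k y, dG k (dG (k + 1) y) = 0) (hψ : ∀ k y, dG k (ψ (k + 1) y) = ψ k (dF k y))
    {n : ℕ} (hn : 1 < n) (hψ0 : Function.Bijective (ψ 0).dualMap)
    (hF0 : ∀ a, (dF 0).dualMap a = 0 → a = 0)
    (hF : ∀ k, k + 1 < n → ∀ a, (dF (k + 1)).dualMap a = 0 → ∃ b, (dF k).dualMap b = a)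
    (hG : ∀ k, k + 1 < n → ∀ a, (dG (k + 1)).dualMap a = 0 → ∃ b, (dG k).dualMap b = a)
    (htop : ∀ k, k + 1 = n → ∀ a b, (ψ (k + 1)).dualMap b = (dF k).dualMap a →
      ∃ c, (dG k).dualMap c = b) (k : ℕ) (hk : k < n) :
    LinearMap.ker (coneD dF dG ψ k) = incoming (coneD dF dG ψ) k := by
  have hdF' : ∀ k a, (dF (k + 1)).dualMap ((dF k).dualMap a) = 0 := fun k a =>
    LinearMap.ext fun y => by simp [hdF]
  have hdG' : ∀ k a, (dG (k + 1)).dualMap ((dG k).dualMap a) = 0 := fun k a =>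
    LinearMap.ext fun y => by simp [hdG]
  have hψ' : ∀ k a, (dF k).dualMap ((ψ k).dualMap a) = (ψ (k + 1)).dualMap ((dG k).dualMap a) :=
    fun k a => LinearMap.ext fun y => by simp [hψ]
  -- For a cocycle `(a, b)`, first `b` is a coboundary `d c`; then `a + ψ^∨ c` is a cocycle, hence
  -- also a coboundary.
  have hlift : ∀ k, k + 1 < n → ∀ (a : Module.Dual R (F (k + 1))) (b : Module.Dual R (G (k + 2))),
      (dF (k + 1)).dualMap a + (ψ (k + 2)).dualMap b = 0 → (dG (k + 2)).dualMap b = 0 →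
      ∃ (c : Module.Dual R (G (k + 1))) (a' : Module.Dual R (F k)),
        (dG (k + 1)).dualMap c = b ∧ (dF k).dualMap a' = a + (ψ (k + 1)).dualMap c := by
    intro k hk a b h1 h2
    obtain ⟨c, hc⟩ : ∃ c, (dG (k + 1)).dualMap c = b := by
      -- Exactness of `G^∨` covers `k + 2 < n`. For `k + 2 = n` the class of `b` dies in the top
      -- cohomology of `F^∨`, and injectivity there applies.
      rcases (Nat.succ_le_of_lt hk).lt_or_eq with h | h
      · exact hG (k + 1) h b h2
      · exact htop (k + 1) h (-a) b (by rw [map_neg]; exact eq_neg_of_add_eq_zero_right h1)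
    obtain ⟨a', ha'⟩ := hF k hk (a + (ψ (k + 1)).dualMap c) (by
      rw [map_add, hψ', hc]; exact h1)
    exact ⟨c, a', hc, ha'⟩
  match k with
  | 0 =>
    refine (Submodule.eq_bot_iff _).2 fun b hb => ?_
    obtain ⟨h1, h2⟩ := coneD_zero_eq_zero_iff.1 hb
    obtain ⟨c, rfl⟩ := hG 0 hn _ (neg_eq_zero.1 h2)
    have : (ψ 0).dualMap c = 0 := hF0 _ (by rw [hψ', h1])
    rw [hψ0.1 (this.trans (map_zero (ψ 0).dualMap).symm)]
    exact map_zero _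
  | 1 =>
    refine Submodule.ext fun a => coneD_succ_eq_zero_iff.trans (Iff.trans ?_ exists_coneD_zero_eq_iff.symm)
    constructor
    · rintro ⟨h1, h2⟩
      obtain ⟨c, a', hc, ha'⟩ := hlift 0 hk _ _ h1 (neg_eq_zero.1 h2)
      -- `F_0^∨` has been cancelled from the cone, so `a'` is moved to `G_0^∨` and absorbed into the
      -- correction of `c`.
      obtain ⟨b', rfl⟩ := hψ0.2 a'
      rw [hψ'] at ha'
      refine ⟨(dG 0).dualMap b' - c, ?_, ?_⟩
      · rw [map_sub, ha']; abel
      · rw [map_sub, hdG', hc]; abel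
    · rintro ⟨b, h1, h2⟩
      rw [← h1, ← h2, hψ', map_neg, map_neg, hdG', neg_zero, neg_zero]
      exact ⟨add_neg_cancel _, rfl⟩
  | k + 2 =>
    refine Submodule.ext fun a => coneD_succ_eq_zero_iff.trans (Iff.trans ?_ exists_coneD_succ_eq_iff.symm)
    constructor
    · rintro ⟨h1, h2⟩
      obtain ⟨c, a', hc, ha'⟩ := hlift (k + 1) hk _ _ h1 (neg_eq_zero.1 h2)
      refine ⟨a', -c, ?_, ?_⟩
      · rw [map_neg, ha']; abel
      · rw [map_neg, hc, neg_neg]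
    · rintro ⟨c, b, h1, h2⟩
      rw [← h1, ← h2, map_add, hdF', hψ', map_neg, map_neg, hdG', neg_zero, neg_zero, zero_add]
      exact ⟨add_neg_cancel _, rfl⟩

end ConeExact

/-! ### Top cohomology and the colon ideal -/

section Top

open exteriorPower RingTheory.Sequence

variable {R : Type*} [CommRing R] {n : ℕ}

theorem formOf_mem {f : Fin n → R} {J : Ideal R} (hf : ∀ j, f j ∈ J) (v : Fin n → R) :
    formOf f v ∈ J := by
  rw [formOf_apply]
  exact Submodule.sum_mem _ fun j _ => J.mul_mem_right _ (hf j)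

theorem exists_formOf_eq {f : Fin n → R} {x : R} (hx : x ∈ Ideal.span (Set.range f)) :
    ∃ v, formOf f v = x := by
  obtain ⟨v, rfl⟩ := (Ideal.mem_span_range_iff_exists_fun).1 hx
  exact ⟨v, by simp [formOf_apply, mul_comm]⟩

theorem koszulD_mem {f : Fin n → R} {J : Ideal R} (hf : ∀ j, f j ∈ J) (p : ℕ)
    (y : ⋀[R]^(p + 1) (Fin n → R)) :
    koszulD f p y ∈ J • (⊤ : Submodule R (⋀[R]^p (Fin n → R))) := by
  have hy : y ∈ Submodule.span R (Set.range (ιMulti R (p + 1) (M := Fin n → R))) := by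
    rw [ιMulti_span]; trivial
  induction hy using Submodule.span_induction with
  | mem x h =>
    obtain ⟨w, rfl⟩ := h
    rw [koszulD_ιMulti]
    refine Submodule.sum_mem _ fun i _ => ?_
    exact zsmul_mem (Submodule.smul_mem_smul (formOf_mem hf _) Submodule.mem_top) _
  | zero => rw [map_zero]; exact Submodule.zero_mem _
  | add x y _ _ hx hy => rw [map_add]; exact Submodule.add_mem _ hx hy
  | smul r x _ hx => rw [map_smul]; exact Submodule.smul_mem _ _ hx

/-- This makes the cancellation of `G_0^∨` against `F_0^∨` possible. -/
theorem map_zero_eq_id (φ : (Fin n → R) →ₗ[R] (Fin n → R)) :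
    exteriorPower.map 0 φ = LinearMap.id := by
  apply linearMap_ext
  ext1 w
  simp only [LinearMap.compAlternatingMap_apply, map_apply_ιMulti, LinearMap.id_apply]
  congr 1
  exact Subsingleton.elim _ _

/-- The standard generator of `⋀^n R^n`. -/
noncomputable def topVec (R : Type*) [CommRing R] (n : ℕ) : ⋀[R]^n (Fin n → R) :=
  ιMulti R n fun i => Pi.single i 1

theorem exists_topDual (R : Type*) [CommRing R] (n : ℕ) :
    ∃ ν : Module.Dual R (⋀[R]^n (Fin n → R)), ν (topVec R n) = 1 ∧ ∀ y, y = ν y • topVec R n := by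
  let s : Set.powersetCard (Fin n) n := ⟨Finset.univ, by simp⟩
  have hs : ∀ t, t = s := fun t => Subtype.ext (Finset.eq_univ_of_card _ (by
    rw [show t.1.card = n from t.2, Fintype.card_fin]))
  let b := (Pi.basisFun R (Fin n)).exteriorPower n
  have hb : b s = topVec R n := by
    rw [basis_apply, topVec, ιMulti_family]
    congr 1
    funext i
    have : ⇑(Set.powersetCard.ofFinEmbEquiv.symm s : Fin n ↪o Fin n) = id :=
      (OrderEmbedding.strictMono _).eq_id
    simp [this]
  refine ⟨b.coord s, by rw [← hb]; simp, fun y => ?_⟩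
  conv_lhs => rw [← b.linearCombination_repr y, Finsupp.linearCombination_apply]
  rw [Finsupp.sum_fintype _ _ (by simp), Finset.sum_eq_single s (fun t _ ht => absurd (hs t) ht)
    (by simp), hb]
  rfl

theorem dual_top_eq (a : Module.Dual R (⋀[R]^n (Fin n → R)))
    {ν : Module.Dual R (⋀[R]^n (Fin n → R))} (hν : ∀ y, y = ν y • topVec R n) :
    a = a (topVec R n) • ν := by
  refine LinearMap.ext fun y => ?_
  conv_lhs => rw [hν y]
  simp [mul_comm]

/-- In the dual homotopy formula the other term passes through `⋀^(n+1) R^n = 0`, so the ideal kills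
top cohomology. -/
theorem exists_koszulD_dualMap_eq_smul {f : Fin n → R} {m : ℕ} (hm : m + 1 = n) {x : R}
    (hx : x ∈ Ideal.span (Set.range f)) (a : Module.Dual R (⋀[R]^(m + 1) (Fin n → R))) :
    ∃ c, (koszulD f m).dualMap c = x • a := by
  obtain ⟨v, rfl⟩ := exists_formOf_eq hx
  refine ⟨(wedge v m).dualMap a, ?_⟩
  have : Subsingleton (⋀[R]^(m + 1 + 1) (Fin n → R)) := subsingleton_exteriorPower (by omega)
  have h0 : (koszulD f (m + 1)).dualMap a = 0 :=
    LinearMap.ext fun y => by rw [Subsingleton.elim y 0]; simp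
  rw [smul_eq_dualMap, h0, map_zero, add_zero]

variable {f g : Fin n → R} {φ : (Fin n → R) →ₗ[R] (Fin n → R)}

/-- The determinant of `φ` is injective from `R/I_Z` to `R/I_X`. -/
theorem exists_koszulD_dualMap_eq_of_map (hf : IsWeaklyRegular R (List.ofFn f))
    (hφ : formOf g ∘ₗ φ = formOf f) (k : ℕ) (hk : k + 1 = n)
    (a : Module.Dual R (⋀[R]^k (Fin n → R))) (b : Module.Dual R (⋀[R]^(k + 1) (Fin n → R)))
    (hab : (exteriorPower.map (k + 1) φ).dualMap b = (koszulD f k).dualMap a) :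
    ∃ c, (koszulD g k).dualMap c = b := by
  subst hk
  obtain ⟨ν, hν1, hν⟩ := exists_topDual R (k + 1)
  set x := b (topVec R (k + 1)) with hx
  have hb : b = x • ν := dual_top_eq b hν
  -- Top forms are multiples of `ν` and `b = x • ν`, so `x • ψ c = c (topVec) • ψ b` is a coboundary
  -- by `hab`.
  obtain ⟨h, hh⟩ := exists_smul_eq_of_top_mem_range
    (C := fun p => Module.Dual R (⋀[R]^p (Fin (k + 1) → R)))
    (D := fun p => Module.Dual R (⋀[R]^p (Fin (k + 1) → R)))
    (fun p => (koszulD g p).dualMap) (fun p => (koszulD f p).dualMap)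
    (fun p => (exteriorPower.map p φ).dualMap)
    (fun p c => LinearMap.ext fun y => by simp [koszulD_koszulD])
    (fun p c => LinearMap.ext fun y => by simp [koszulD_map hφ])
    (m := k) (eq_zero_of_koszulD_dualMap_eq_zero hf (by omega))
    (fun p hp => exists_koszulD_dualMap_eq hf p (by omega)) x (fun c => by
      refine ⟨c (topVec R (k + 1)) • a, ?_⟩
      rw [map_smul, ← hab, hb, ← map_smul, ← map_smul, smul_smul, mul_comm, ← smul_smul,
        ← dual_top_eq c hν])
  -- In degree `0` the homotopy reads `x • ε = h (d ε)`, and `d ε` has coefficients in the ideal of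
  -- `g`; evaluation at the generator of `⋀^0` gives `x`.
  have hxg : x ∈ Ideal.span (Set.range g) := by
    let ε : Module.Dual R (⋀[R]^0 (Fin (k + 1) → R)) := (zeroEquiv R (Fin (k + 1) → R)).toLinearMap
    have h1 : (koszulD g 0).dualMap ε ∈ Ideal.span (Set.range g) •
        (⊤ : Submodule R (Module.Dual R (⋀[R]^(0 + 1) (Fin (k + 1) → R)))) :=
      dual_mem_ideal_smul_top fun y => apply_mem_of_mem_ideal_smul_top
        (koszulD_mem (fun j => Ideal.subset_span (Set.mem_range_self j)) 0 y) ε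
    have h2 := map_mem_ideal_smul_top h h1
    rw [← hh] at h2
    have h3 := apply_mem_of_mem_ideal_smul_top h2
      (Module.Dual.eval R _ (ιMulti R 0 (fun _ => 0 : Fin 0 → Fin (k + 1) → R)))
    simpa [map_zero_eq_id, ε, -ιMulti_apply_coe] using h3
  obtain ⟨c, hc⟩ := exists_koszulD_dualMap_eq_smul (f := g) rfl hxg ν
  exact ⟨c, hc.trans hb.symm⟩

theorem exists_koszulD_zero_eq {f : Fin n → R} {y : ⋀[R]^0 (Fin n → R)}
    (hy : y ∈ Ideal.span (Set.range f) • (⊤ : Submodule R (⋀[R]^0 (Fin n → R)))) :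
    ∃ w, koszulD f 0 w = y := by
  rw [← LinearMap.mem_range]
  refine Submodule.smul_induction_on hy (fun r hr a _ => ?_) fun a b ha hb =>
    Submodule.add_mem _ ha hb
  obtain ⟨v, rfl⟩ := exists_formOf_eq hr
  exact ⟨wedge v 0 a, koszulD_wedge_zero f v a⟩

theorem smul_mem_of_mem_colon {M : Type*} [AddCommGroup M] [Module R M] {I J : Ideal R} {z : R}
    (hz : z ∈ I.colon J) {y : M} (hy : y ∈ J • (⊤ : Submodule R M)) :
    z • y ∈ I • (⊤ : Submodule R M) := by
  refine Submodule.smul_induction_on hy (fun r hr a _ => ?_) fun a b ha hb => ?_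
  · rw [smul_smul]
    exact Submodule.smul_mem_smul (Submodule.mem_colon.1 hz r hr) trivial
  · rw [smul_add]
    exact Submodule.add_mem _ ha hb

/-- `I_X : I_Z` is contained in `I_X + (det φ)`. -/
theorem exists_smul_eq_of_mem_colon (hf : IsWeaklyRegular R (List.ofFn f))
    (hφ : formOf g ∘ₗ φ = formOf f) {m : ℕ} (hm : m + 1 = n) {z : R}
    (hz : z ∈ (Ideal.span (Set.range f)).colon (Ideal.span (Set.range g)))
    (a : Module.Dual R (⋀[R]^(m + 1) (Fin n → R))) :
    ∃ a' b, z • a = (koszulD f m).dualMap a' + (exteriorPower.map (m + 1) φ).dualMap b := by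
  -- The lift starts with `z` itself in degree `0`: since `z I_Z ⊆ I_X`, it sends boundaries for `g`
  -- to boundaries for `f`.
  obtain ⟨ζ, h, -, hh⟩ := exists_lift_homotopy
    (F := fun p => ⋀[R]^p (Fin n → R)) (G := fun p => ⋀[R]^p (Fin n → R))
    (koszulD f) (koszulD g) (fun p => exteriorPower.map p φ) (koszulD_koszulD f)
    (koszulD_koszulD g) (koszulD_map hφ) (exists_koszulD_eq hf) z (z • LinearMap.id)
    (fun y => by simp [map_zero_eq_id]) (fun y => exists_koszulD_zero_eq (by
      simpa using smul_mem_of_mem_colon hz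
        (koszulD_mem (fun j => Ideal.subset_span (Set.mem_range_self j)) 0 y))) m
  refine ⟨-(a ∘ₗ h), a ∘ₗ ζ, LinearMap.ext fun y => ?_⟩
  -- Nothing lies above the top degree, so the cycle in `hh` is zero: `z = ζ ∘ ⋀φ - h ∘ d`.
  have : Subsingleton (⋀[R]^(m + 1 + 1) (Fin n → R)) := subsingleton_exteriorPower (by omega)
  obtain ⟨w, hw⟩ := exists_koszulD_eq hf m _ (hh y)
  rw [Subsingleton.elim w 0, map_zero] at hw
  have := congrArg a hw
  simp only [map_zero, map_sub, map_smul] at this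
  simp only [LinearMap.smul_apply, LinearMap.add_apply, LinearMap.dualMap_apply,
    LinearMap.neg_apply, LinearMap.comp_apply]
  linear_combination this

/-- `I_X + (det φ)` is contained in `I_X : I_Z`. -/
theorem apply_mem_colon (hφ : formOf g ∘ₗ φ = formOf f) {m : ℕ} (hm : m + 1 = n)
    (a : Module.Dual R (⋀[R]^m (Fin n → R))) (b : Module.Dual R (⋀[R]^(m + 1) (Fin n → R)))
    (y : ⋀[R]^(m + 1) (Fin n → R)) :
    ((koszulD f m).dualMap a + (exteriorPower.map (m + 1) φ).dualMap b) y ∈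
      (Ideal.span (Set.range f)).colon (Ideal.span (Set.range g)) := by
  have hd : ∀ (a : Module.Dual R (⋀[R]^m (Fin n → R))) y,
      a (koszulD f m y) ∈ Ideal.span (Set.range f) := fun a y =>
    apply_mem_of_mem_ideal_smul_top (koszulD_mem (fun j => Ideal.subset_span (Set.mem_range_self j)) m y) a
  refine Submodule.mem_colon.2 fun s hs => ?_
  -- Since `s • b = d c`, `s` times the pullback of `b` is the coboundary of the pullback of `c`,
  -- with values in `I_X`.
  obtain ⟨c, hc⟩ := exists_koszulD_dualMap_eq_smul hm hs b
  have := LinearMap.congr_fun hc (exteriorPower.map (m + 1) φ y)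
  simp only [LinearMap.dualMap_apply, LinearMap.smul_apply, koszulD_map hφ] at this
  rw [smul_eq_mul, mul_comm, LinearMap.add_apply, mul_add, LinearMap.dualMap_apply,
    LinearMap.dualMap_apply, ← smul_eq_mul s (b _), ← this]
  exact Ideal.add_mem _ (Ideal.mul_mem_left _ _ (hd _ _))
    (hd (c ∘ₗ exteriorPower.map m φ) y)

end Top

end LinkageCone

namespace LinkageCone

open MvPolynomial

universe u v

/-! ### Homogeneous polynomials in integer degrees -/

section PolyGr

variable {K : Type u} [Field K] {σ : Type v}

theorem polyGr_of_nonneg {k : ℤ} (hk : 0 ≤ k) {p : MvPolynomial σ K} :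
    p ∈ polyGr K σ k ↔ p.IsHomogeneous k.toNat := by
  rw [polyGr, if_pos hk]
  exact mem_homogeneousSubmodule _ _

theorem polyGr_of_neg {k : ℤ} (hk : k < 0) : polyGr K σ k = ⊥ := if_neg (not_le.2 hk)

theorem mem_polyGr_natCast {d : ℕ} {p : MvPolynomial σ K} :
    p ∈ polyGr K σ d ↔ p.IsHomogeneous d := by
  rw [polyGr_of_nonneg (Int.natCast_nonneg d), Int.toNat_natCast]

theorem one_mem_polyGr : (1 : MvPolynomial σ K) ∈ polyGr K σ 0 :=
  mem_polyGr_natCast.2 (isHomogeneous_one σ K)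

theorem mul_mem_polyGr {a b : ℤ} {p q : MvPolynomial σ K} (hp : p ∈ polyGr K σ a)
    (hq : q ∈ polyGr K σ b) : p * q ∈ polyGr K σ (a + b) := by
  rcases lt_or_ge a 0 with ha | ha
  · rw [polyGr_of_neg ha, AddSubgroup.mem_bot] at hp
    rw [hp, zero_mul]
    exact zero_mem _
  rcases lt_or_ge b 0 with hb | hb
  · rw [polyGr_of_neg hb, AddSubgroup.mem_bot] at hq
    rw [hq, mul_zero]
    exact zero_mem _
  rw [polyGr_of_nonneg ha] at hp
  rw [polyGr_of_nonneg hb] at hq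
  rw [polyGr_of_nonneg (by omega), Int.toNat_add ha hb]
  exact hp.mul hq

theorem mul_mem_polyGr_of_eq {a b c : ℤ} {p q : MvPolynomial σ K} (hp : p ∈ polyGr K σ a)
    (hq : q ∈ polyGr K σ b) (h : a + b = c) : p * q ∈ polyGr K σ c :=
  h ▸ mul_mem_polyGr hp hq

theorem prod_mem_polyGr {ι : Type*} (s : Finset ι) {a : ι → ℤ} {p : ι → MvPolynomial σ K}
    (hp : ∀ i ∈ s, p i ∈ polyGr K σ (a i)) : ∏ i ∈ s, p i ∈ polyGr K σ (∑ i ∈ s, a i) := by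
  classical
  induction s using Finset.induction_on with
  | empty => simpa using one_mem_polyGr
  | insert i s hi ih =>
    rw [Finset.prod_insert hi, Finset.sum_insert hi]
    exact mul_mem_polyGr (hp i (Finset.mem_insert_self i s))
      (ih fun j hj => hp j (Finset.mem_insert_of_mem hj))

/-- The degree of a Leibniz term does not depend on the permutation. -/
theorem det_mem_polyGr {ι : Type*} [Fintype ι] [DecidableEq ι]
    {A : Matrix ι ι (MvPolynomial σ K)} {a b : ι → ℤ}
    (h : ∀ i j, A i j ∈ polyGr K σ (a i - b j)) :
    A.det ∈ polyGr K σ (∑ i, a i - ∑ j, b j) := by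
  rw [Matrix.det_apply]
  refine sum_mem fun τ _ => ?_
  rw [Units.smul_def]
  refine zsmul_mem ?_ _
  have := prod_mem_polyGr Finset.univ (a := fun i => a (τ i) - b i) fun i _ => h (τ i) i
  rwa [Finset.sum_sub_distrib, Equiv.sum_comp τ a] at this

/-- The degree `D` part of `c * g` is `c' * g` for `g` homogeneous and a graded part `c'` of `c`. -/
theorem exists_homogeneousComponent_mul_eq {g : MvPolynomial σ K} {e : ℕ} (hg : g.IsHomogeneous e)
    (D : ℕ) (c : MvPolynomial σ K) :
    ∃ c' ∈ polyGr K σ ((D : ℤ) - e), homogeneousComponent D (c * g) = c' * g := by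
  have key : homogeneousComponent D (c * g) = ∑ i ∈ Finset.range (c.totalDegree + 1),
      if i + e = D then homogeneousComponent i c * g else 0 := by
    conv_lhs => rw [← sum_homogeneousComponent c, Finset.sum_mul, map_sum]
    refine Finset.sum_congr rfl fun i _ => ?_
    rw [homogeneousComponent_of_mem (n := i + e)
      ((mem_homogeneousSubmodule _ _).2 ((homogeneousComponent_isHomogeneous i c).mul hg))]
    simp only [eq_comm]
  -- At most one summand survives; for `D < e` none does, matching `polyGr` being zero in negative
  -- degrees.
  refine ⟨∑ i ∈ Finset.range (c.totalDegree + 1),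
    if i + e = D then homogeneousComponent i c else 0, sum_mem fun i _ => ?_, ?_⟩
  · split_ifs with h
    · rw [show (D : ℤ) - e = i by omega]
      exact mem_polyGr_natCast.2 (homogeneousComponent_isHomogeneous i c)
    · exact zero_mem _
  · rw [key, Finset.sum_mul]
    simp only [ite_mul, zero_mul]

theorem mem_irrelevant_of_isHomogeneous {p : MvPolynomial σ K} {d : ℕ} (hp : p.IsHomogeneous d)
    (hd : d ≠ 0) : p ∈ irrelevant K σ := by
  rw [irrelevant, ← Set.image_univ, mem_ideal_span_X_image]
  intro m hm
  by_contra! h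
  have h0 : m = 0 := Finsupp.ext fun i => h i (Set.mem_univ i)
  have := hp (mem_support_iff.1 hm)
  rw [h0, map_zero] at this
  exact hd this.symm

/-- Degree `0` is allowed: a constant in a proper ideal is zero. -/
theorem mem_irrelevant_of_ne_top {p : MvPolynomial σ K} {d : ℕ} (hp : p.IsHomogeneous d)
    {I : Ideal (MvPolynomial σ K)} (hI : I ≠ ⊤) (hpI : p ∈ I) : p ∈ irrelevant K σ := by
  rcases Nat.eq_zero_or_pos d with rfl | hd
  · have hc := totalDegree_eq_zero_iff_eq_C.1 ((totalDegree_zero_iff_isHomogeneous σ).2 hp)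
    rcases eq_or_ne (coeff 0 p) 0 with h0 | h0
    · rw [hc, h0, C_0]
      exact zero_mem _
    · refine absurd (I.eq_top_of_isUnit_mem hpI ?_) hI
      rw [hc]
      exact (isUnit_iff_ne_zero.2 h0).map C
  · exact mem_irrelevant_of_isHomogeneous hp hd.ne'

end PolyGr

/-! ### Gradings on exterior powers, duals and sums -/

section Graded

variable {K : Type u} [Field K] {σ : Type v} {n : ℕ}

theorem mem_freeGr {ι : Type} {d : ι → ℕ} {m : ℤ} {v : ι → MvPolynomial σ K} :
    v ∈ freeGr d m ↔ ∀ j, v j ∈ polyGr K σ (m - d j) := by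
  simp [freeGr, AddSubgroup.mem_pi]

theorem single_mem_freeGr {ι : Type} [DecidableEq ι] (d : ι → ℕ) (i : ι) :
    (Pi.single i 1 : ι → MvPolynomial σ K) ∈ freeGr d (d i) := by
  rw [mem_freeGr]
  intro j
  rcases eq_or_ne j i with rfl | h
  · simpa using one_mem_polyGr
  · rw [Pi.single_eq_of_ne h]
    exact zero_mem _

theorem formOf_mem_polyGr {f : Fin n → MvPolynomial σ K} {d : Fin n → ℕ}
    (hf : ∀ i, (f i).IsHomogeneous (d i)) {m : ℤ} {v : Fin n → MvPolynomial σ K}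
    (hv : v ∈ freeGr d m) : formOf f v ∈ polyGr K σ m := by
  rw [formOf_apply]
  exact sum_mem fun j _ => mul_mem_polyGr_of_eq (mem_polyGr_natCast.2 (hf j)) (mem_freeGr.1 hv j)
    (by ring)

section

variable {M N : Type*} [AddCommGroup M] [Module (MvPolynomial σ K) M] [AddCommGroup N]
  [Module (MvPolynomial σ K) N] {gr : ℤ → AddSubgroup M} {gr' : ℤ → AddSubgroup N}

theorem smul_ιMulti_mem_extGr {p : ℕ} {k : ℤ} {s : Fin p → ℤ} {r : MvPolynomial σ K}
    {w : Fin p → M} (hr : r ∈ polyGr K σ k) (hw : ∀ i, w i ∈ gr (s i)) {m : ℤ}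
    (hm : k + ∑ i, s i = m) :
    r • exteriorPower.ιMulti (MvPolynomial σ K) p w ∈ extGr gr p m :=
  AddSubgroup.subset_closure ⟨k, s, r, w, hr, hw, hm, rfl⟩

theorem map_mem_of_mem_extGr {p : ℕ} {T : (⋀[MvPolynomial σ K]^p M) →ₗ[MvPolynomial σ K] N}
    {m : ℤ} {H : AddSubgroup N}
    (hT : ∀ (k : ℤ) (s : Fin p → ℤ) (r : MvPolynomial σ K) (w : Fin p → M),
      r ∈ polyGr K σ k → (∀ i, w i ∈ gr (s i)) → k + ∑ i, s i = m →
      r • T (exteriorPower.ιMulti (MvPolynomial σ K) p w) ∈ H)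
    {x : ⋀[MvPolynomial σ K]^p M} (hx : x ∈ extGr gr p m) : T x ∈ H := by
  refine (AddSubgroup.closure_le (H.comap T.toAddMonoidHom)).2 ?_ hx
  rintro _ ⟨k, s, r, w, hr, hw, hm, rfl⟩
  simpa using hT k s r w hr hw hm

theorem map_mem_extGr {φ : M →ₗ[MvPolynomial σ K] N} (hφ : ∀ m, ∀ v ∈ gr m, φ v ∈ gr' m)
    (p : ℕ) (m : ℤ) {x : ⋀[MvPolynomial σ K]^p M} (hx : x ∈ extGr gr p m) :
    exteriorPower.map p φ x ∈ extGr gr' p m := by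
  refine map_mem_of_mem_extGr (fun k s r w hr hw hm => ?_) hx
  rw [exteriorPower.map_apply_ιMulti]
  exact smul_ιMulti_mem_extGr hr (fun i => hφ _ _ (hw i)) hm

theorem dualMap_mem_dualGr {T : M →ₗ[MvPolynomial σ K] N} (hT : ∀ m, ∀ v ∈ gr m, T v ∈ gr' m)
    {m : ℤ} {l : Module.Dual (MvPolynomial σ K) N} (hl : l ∈ dualGr gr' m) :
    T.dualMap l ∈ dualGr gr m :=
  fun k x hx => hl k _ (hT k x hx)

theorem IsGradedFree.reindex {ι ι' : Type} {s : ι → ℤ} (h : IsGradedFree (K := K) (σ := σ) gr s)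
    (e : ι' ≃ ι) : IsGradedFree (K := K) (σ := σ) gr (s ∘ e) := by
  obtain ⟨b, hb⟩ := h
  refine ⟨b.reindex e.symm, fun m x => (hb m x).trans ?_⟩
  rw [← e.forall_congr_right]
  simp

theorem IsGradedFree.shift {ι : Type} {s : ι → ℤ} (h : IsGradedFree (K := K) (σ := σ) gr s)
    (a : ℤ) : IsGradedFree (K := K) (σ := σ) (shiftGr gr a) (fun j => s j - a) := by
  obtain ⟨b, hb⟩ := h
  refine ⟨b, fun m x => (hb (a + m) x).trans (forall_congr' fun j => ?_)⟩
  rw [show a + m - s j = m - (s j - a) by ring]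

theorem IsGradedFree.prod {ι ι' : Type} {s : ι → ℤ} {s' : ι' → ℤ}
    (h : IsGradedFree (K := K) (σ := σ) gr s) (h' : IsGradedFree (K := K) (σ := σ) gr' s') :
    IsGradedFree (K := K) (σ := σ) (fun m => (gr m).prod (gr' m)) (Sum.elim s s') := by
  obtain ⟨b, hb⟩ := h
  obtain ⟨b', hb'⟩ := h'
  refine ⟨b.prod b', fun m x => ?_⟩
  rw [AddSubgroup.mem_prod, hb, hb', Sum.forall]
  simp

theorem IsGradedFree.dual {ι : Type} [Finite ι] {s : ι → ℤ}
    (h : IsGradedFree (K := K) (σ := σ) gr s) :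
    IsGradedFree (K := K) (σ := σ) (dualGr (K := K) (σ := σ) gr) (fun j => - s j) := by
  classical
  have := Fintype.ofFinite ι
  obtain ⟨b, hb⟩ := h
  refine ⟨b.dualBasis, fun m l => ?_⟩
  simp only [b.dualBasis_repr]
  constructor
  · intro hl j
    have : b j ∈ gr (s j) := (hb _ _).2 fun i => by
      rcases eq_or_ne j i with rfl | hij
      · simpa using one_mem_polyGr
      · rw [b.repr_self, Finsupp.single_eq_of_ne hij.symm]
        exact zero_mem _
    rw [show m - -s j = s j + m by ring]
    exact hl _ _ this
  · intro hl k x hx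
    rw [← b.sum_repr x, map_sum]
    refine sum_mem fun j _ => ?_
    rw [map_smul, smul_eq_mul]
    exact mul_mem_polyGr_of_eq ((hb k x).1 hx j) (hl j) (by ring)

end

theorem koszulD_mem_extGr {f : Fin n → MvPolynomial σ K} {d : Fin n → ℕ}
    (hf : ∀ i, (f i).IsHomogeneous (d i)) (p : ℕ) (m : ℤ)
    {x : ⋀[MvPolynomial σ K]^(p + 1) (Fin n → MvPolynomial σ K)}
    (hx : x ∈ extGr (freeGr (K := K) (σ := σ) d) (p + 1) m) : koszulD f p x ∈ extGr (freeGr (K := K) (σ := σ) d) p m := by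
  refine map_mem_of_mem_extGr (fun k s r w hr hw hm => ?_) hx
  rw [koszulD_ιMulti, Finset.smul_sum]
  refine sum_mem fun i _ => ?_
  rw [smul_comm]
  refine zsmul_mem ?_ _
  rw [smul_smul]
  -- Omitting `w i` loses the degree `s i`, which the coefficient `formOf f (w i)` restores.
  refine smul_ιMulti_mem_extGr (s := i.removeNth s)
    (mul_mem_polyGr hr (formOf_mem_polyGr hf (hw i))) (fun j => hw _) ?_
  rw [← hm, Fin.sum_univ_succAbove s i, add_assoc]
  rfl

theorem sum_ofFinEmbEquiv_symm {I A : Type*} [LinearOrder I] [AddCommMonoid A] {p : ℕ}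
    (S : Set.powersetCard I p) (a : I → A) :
    ∑ i, a (Set.powersetCard.ofFinEmbEquiv.symm S i) = ∑ j ∈ S.1, a j := by
  refine Finset.sum_bij (fun i _ => Set.powersetCard.ofFinEmbEquiv.symm S i) (fun i _ => ?_)
    (fun i _ j _ h => (Set.powersetCard.ofFinEmbEquiv.symm S).injective h) (fun j hj => ?_) fun _ _ => rfl
  · exact (Set.powersetCard.mem_range_ofFinEmbEquiv_symm_iff_mem S _).1 ⟨i, rfl⟩
  · obtain ⟨i, hi⟩ := (Set.powersetCard.mem_range_ofFinEmbEquiv_symm_iff_mem S j).2 hj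
    exact ⟨i, Finset.mem_univ i, hi⟩

/-- In the standard basis, the coordinates of `w₁ ∧ ⋯ ∧ w_p` are minors, homogeneous by
`det_mem_polyGr`. -/
theorem isGradedFree_extGr (d : Fin n → ℕ) (p : ℕ) :
    IsGradedFree (K := K) (σ := σ) (extGr (K := K) (σ := σ) (freeGr (K := K) (σ := σ) d) p)
      (fun S : Set.powersetCard (Fin n) p => ∑ j ∈ S.1, (d j : ℤ)) := by
  let b := (Pi.basisFun (MvPolynomial σ K) (Fin n)).exteriorPower p
  refine ⟨b, fun m x => ⟨fun hx S => ?_, fun hx => ?_⟩⟩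
  · refine map_mem_of_mem_extGr (T := b.coord S) (fun k s r w hr hw hm => ?_) hx
    rw [exteriorPower.basis_coord, exteriorPower.ιMultiDual_apply_ιMulti, smul_eq_mul]
    refine mul_mem_polyGr_of_eq hr (det_mem_polyGr (a := s)
      (b := fun j => (d (Set.powersetCard.ofFinEmbEquiv.symm S j) : ℤ)) fun i j => ?_) ?_
    · simpa using mem_freeGr.1 (hw i) _
    · rw [sum_ofFinEmbEquiv_symm S fun j => (d j : ℤ), ← hm]; ring
  · rw [← b.sum_repr x]
    refine sum_mem fun S _ => ?_
    rw [exteriorPower.basis_apply, exteriorPower.ιMulti_family]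
    refine smul_ιMulti_mem_extGr (hx S)
      (s := fun i => (d (Set.powersetCard.ofFinEmbEquiv.symm S i) : ℤ)) (fun i => ?_) ?_
    · simpa using single_mem_freeGr d (Set.powersetCard.ofFinEmbEquiv.symm S i)
    · rw [sum_ofFinEmbEquiv_symm S fun j => (d j : ℤ)]; ring

theorem topVec_mem_extGr (d : Fin n → ℕ) :
    topVec (MvPolynomial σ K) n ∈ extGr (freeGr (K := K) (σ := σ) d) n (∑ j, (d j : ℤ)) := by
  have := smul_ιMulti_mem_extGr (one_mem_polyGr (K := K) (σ := σ))
    (fun i => single_mem_freeGr (K := K) (σ := σ) d i) (zero_add (∑ j, (d j : ℤ)))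
  rwa [one_smul] at this

end Graded

end LinkageCone

namespace LinkageCone

open MvPolynomial

universe u v

/-! ### Minimality -/

section Minimality

open exteriorPower RingTheory.Sequence

variable {R : Type*} [CommRing R] {n : ℕ}

/-- One factor `φ (w 0)` in `J` suffices by multilinearity; degree `0` is excluded because `⋀^0 φ`
is the identity. -/
theorem map_mem_ideal_smul_top_of_forall {φ : (Fin n → R) →ₗ[R] (Fin n → R)} {J : Ideal R}
    (hφ : ∀ v i, φ v i ∈ J) (p : ℕ) (y : ⋀[R]^(p + 1) (Fin n → R)) :
    exteriorPower.map (p + 1) φ y ∈ J • (⊤ : Submodule R (⋀[R]^(p + 1) (Fin n → R))) := by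
  have hy : y ∈ Submodule.span R (Set.range (ιMulti R (p + 1) (M := Fin n → R))) := by
    rw [ιMulti_span]; trivial
  induction hy using Submodule.span_induction with
  | mem x h =>
    obtain ⟨w, rfl⟩ := h
    have h1 : φ (w 0) ∈ J • (⊤ : Submodule R (Fin n → R)) :=
      (mem_ideal_smul_top_iff_repr (Pi.basisFun R (Fin n)) J _).2 fun i => by
        simpa using hφ (w 0) i
    have h2 := map_mem_ideal_smul_top ((ιMulti R (p + 1)).toMultilinearMap.toLinearMap (φ ∘ w) 0) h1
    rw [map_apply_ιMulti]
    have h3 : Function.update (φ ∘ w) 0 (φ (w 0)) = φ ∘ w := Function.update_eq_self 0 (φ ∘ w)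
    rw [MultilinearMap.toLinearMap_apply, h3] at h2
    exact h2
  | zero => rw [map_zero]; exact Submodule.zero_mem _
  | add x y _ _ hx hy => rw [map_add]; exact Submodule.add_mem _ hx hy
  | smul r x _ hx => rw [map_smul]; exact Submodule.smul_mem _ _ hx

/-- By Koszul exactness in degree `1`, every syzygy is a boundary. -/
theorem mem_span_of_formOf_eq_zero {g : Fin n → R} (hg : IsWeaklyRegular R (List.ofFn g))
    {w : Fin n → R} (hw : formOf g w = 0) (i : Fin n) : w i ∈ Ideal.span (Set.range g) := by
  obtain ⟨b, hb⟩ := exists_koszulD_eq hg 0 (ιMulti R 1 fun _ => w) (by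
    rw [koszulD_ιMulti]; simp [hw])
  have := apply_mem_of_mem_ideal_smul_top
    (koszulD_mem (f := g) (fun j => Ideal.subset_span (Set.mem_range_self j)) 1 b)
    (LinearMap.proj i ∘ₗ (oneEquiv R (Fin n → R)).toLinearMap)
  rw [hb] at this
  simpa [oneEquiv_ιMulti, -ιMulti_apply_coe] using this

/-- The entries of `φ` lie in `J` if `I_X ⊆ J I_Z` and `I_Z ⊆ J`. -/
theorem apply_mem_of_formOf_comp_eq {f g : Fin n → R} (hg : IsWeaklyRegular R (List.ofFn g))
    {φ : (Fin n → R) →ₗ[R] (Fin n → R)} (hφ : formOf g ∘ₗ φ = formOf f) {J : Ideal R}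
    (hgJ : Ideal.span (Set.range g) ≤ J) (hf : ∀ j, f j ∈ J * Ideal.span (Set.range g))
    (v : Fin n → R) (i : Fin n) : φ v i ∈ J := by
  have key : ∀ j, φ (Pi.single j 1) i ∈ J := by
    intro j
    -- Column `j` of `φ` is compared with an expression of `f j` whose coefficients `a` lie in `J`;
    -- the difference is a syzygy of `g`.
    obtain ⟨a, ha, hsum⟩ := (Submodule.mem_ideal_smul_span_iff_exists_sum J g (f j)).1 (hf j)
    have h0 : formOf g (φ (Pi.single j 1) - a) = 0 := by
      have h1 := LinearMap.congr_fun hφ (Pi.single j 1)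
      have h2 : formOf f (Pi.single j 1) = f j := by simp [formOf_apply, Pi.single_apply]
      rw [LinearMap.comp_apply, h2] at h1
      rw [map_sub, h1, ← hsum, formOf_apply, Finsupp.sum_fintype _ _ (by simp)]
      simp [mul_comm]
    have := J.add_mem (hgJ (mem_span_of_formOf_eq_zero hg h0 i)) (ha i)
    simpa using this
  rw [← (Pi.basisFun R (Fin n)).sum_repr v, map_sum, Finset.sum_apply]
  refine Submodule.sum_mem _ fun j _ => ?_
  rw [map_smul, Pi.smul_apply, Pi.basisFun_apply]
  exact J.mul_mem_left _ (key j)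

theorem mk_mem_ideal_smul_top {M N : Type*} [AddCommGroup M] [Module R M] [AddCommGroup N]
    [Module R N] {J : Ideal R} {x : M × N} (h1 : x.1 ∈ J • (⊤ : Submodule R M))
    (h2 : x.2 ∈ J • (⊤ : Submodule R N)) : x ∈ J • (⊤ : Submodule R (M × N)) := by
  have := Submodule.add_mem _ (map_mem_ideal_smul_top (LinearMap.inl R M N) h1)
    (map_mem_ideal_smul_top (LinearMap.inr R M N) h2)
  simpa using this

end Minimality

section ConeMinimal

variable {R : Type u} [CommRing R] {F G : ℕ → Type u} [∀ k, AddCommGroup (F k)]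
  [∀ k, Module R (F k)] [∀ k, AddCommGroup (G k)] [∀ k, Module R (G k)]
  [∀ k, Module.Free R (F k)] [∀ k, Module.Finite R (F k)]
  [∀ k, Module.Free R (G k)] [∀ k, Module.Finite R (G k)]

theorem range_coneD_le {dF : ∀ k, F (k + 1) →ₗ[R] F k} {dG : ∀ k, G (k + 1) →ₗ[R] G k}
    {ψ : ∀ k, F k →ₗ[R] G k} {J : Ideal R} (hF : ∀ k y, dF k y ∈ J • (⊤ : Submodule R (F k)))
    (hG : ∀ k y, dG k y ∈ J • (⊤ : Submodule R (G k)))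
    (hψ : ∀ k y, ψ (k + 1) y ∈ J • (⊤ : Submodule R (G (k + 1)))) (k : ℕ) :
    LinearMap.range (coneD dF dG ψ k) ≤ J • ⊤ := by
  have h : ∀ {M N : Type u} [AddCommGroup M] [Module R M] [AddCommGroup N] [Module R N]
      [Module.Free R M] [Module.Finite R M] (T : M →ₗ[R] N) (l : Module.Dual R N),
      (∀ y, T y ∈ J • (⊤ : Submodule R N)) →
      T.dualMap l ∈ J • (⊤ : Submodule R (Module.Dual R M)) := fun T l hT =>
    dual_mem_ideal_smul_top fun y => apply_mem_of_mem_ideal_smul_top (hT y) l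
  match k with
  | 0 =>
    rintro _ ⟨b, rfl⟩
    exact mk_mem_ideal_smul_top (h (ψ 1) b (hψ 0)) (Submodule.neg_mem _ (h (dG 1) b (hG 1)))
  | k + 1 =>
    rintro _ ⟨⟨a, b⟩, rfl⟩
    exact mk_mem_ideal_smul_top
      (Submodule.add_mem _ (h (dF (k + 1)) a (hF _)) (h (ψ (k + 2)) b (hψ _)))
      (Submodule.neg_mem _ (h (dG (k + 2)) b (hG _)))

end ConeMinimal

/-! ### Existence of a graded comparison map -/

section Comparison

variable {K : Type u} [Field K] {σ : Type} {n : ℕ}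

/-- In any expression of `f j` through the `g i`, the parts of degree `d j` already give one with
homogeneous coefficients. -/
theorem exists_isComparison {f g : Fin n → MvPolynomial σ K} {d e : Fin n → ℕ}
    (hf : ∀ i, (f i).IsHomogeneous (d i)) (hg : ∀ i, (g i).IsHomogeneous (e i))
    (hfg : ∀ j, f j ∈ Ideal.span (Set.range g)) : ∃ φ, IsComparison f g d e φ := by
  have key : ∀ j, ∃ a : Fin n → MvPolynomial σ K,
      (∀ i, a i ∈ polyGr K σ ((d j : ℤ) - e i)) ∧ ∑ i, a i * g i = f j := by
    intro j
    obtain ⟨c, hc⟩ := Ideal.mem_span_range_iff_exists_fun.1 (hfg j)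
    choose a ha hac using fun i => exists_homogeneousComponent_mul_eq (hg i) (d j) (c i)
    refine ⟨a, ha, ?_⟩
    rw [← homogeneousComponent_eq_self (hf j), ← hc, map_sum]
    exact Finset.sum_congr rfl fun i _ => (hac i).symm
  choose a ha hac using key
  refine ⟨(Matrix.of fun i j => a j i).mulVecLin, ⟨fun m v hv => ?_, ?_⟩⟩
  · rw [mem_freeGr] at hv ⊢
    intro i
    rw [Matrix.mulVecLin_apply, Matrix.mulVec, dotProduct]
    exact sum_mem fun j _ => mul_mem_polyGr_of_eq (ha j i) (hv j) (by ring)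
  · refine LinearMap.ext fun v => ?_
    simp only [LinearMap.comp_apply, formOf_apply, Matrix.mulVecLin_apply, Matrix.mulVec,
      dotProduct, Matrix.of_apply, ← hac, Finset.mul_sum, Finset.sum_mul]
    rw [Finset.sum_comm]
    exact Finset.sum_congr rfl fun j _ => Finset.sum_congr rfl fun i _ => by ring

end Comparison

/-! ### Assembly of the resolution -/

section Assembly

variable {K : Type u} [Field K] {σ : Type} {n : ℕ}

/-- The index set of `linkShifts` in degree `k + 1`, in terms of the indices of the standard bases
of exterior powers. -/
def powersetCardEquivLink (n : ℕ) (k : ℕ) :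
    {S : Finset (Fin n) // 0 < k + 1 ∧ S.card = k + 1} ⊕ {T : Finset (Fin n) // T.card = k + 2} ≃
      Set.powersetCard (Fin n) (k + 1) ⊕ Set.powersetCard (Fin n) (k + 2) :=
  Equiv.sumCongr (Equiv.subtypeEquivRight fun _ => ⟨fun h => h.2, fun h => ⟨k.succ_pos, h⟩⟩)
    (Equiv.refl _)

theorem isGradedFree_dual_extGr (e : Fin n → ℕ) (α : ℤ) (p : ℕ) :
    IsGradedFree (K := K) (σ := σ)
      (shiftGr (dualGr (K := K) (σ := σ) (extGr (K := K) (σ := σ) (freeGr (K := K) (σ := σ) e) p)) (-α))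
      (fun S : Set.powersetCard (Fin n) p => α - ∑ j ∈ S.1, (e j : ℤ)) := by
  convert ((isGradedFree_extGr (K := K) (σ := σ) e p).dual.shift (-α)) using 2
  ring

theorem isGradedFree_linkGr (d e : Fin n → ℕ) (k : ℕ) :
    IsGradedFree (K := K) (σ := σ) (linkGr K σ d e k) (linkShifts d e (∑ j, (d j : ℤ)) k) := by
  match k with
  | 0 =>
    have : IsEmpty {S : Finset (Fin n) // 0 < 0 ∧ S.card = 0} := ⟨fun S => (lt_irrefl 0 S.2.1)⟩
    have h := (isGradedFree_dual_extGr (K := K) (σ := σ) e (∑ j, (d j : ℤ)) 1).reindex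
      (Equiv.emptySum {S : Finset (Fin n) // 0 < 0 ∧ S.card = 0} _)
    refine Eq.mp (congrArg (IsGradedFree (linkGr K σ d e 0)) (funext fun S => ?_)) h
    rcases S with S | S
    · exact isEmptyElim S
    · rfl
  | k + 1 =>
    have h := ((isGradedFree_dual_extGr (K := K) (σ := σ) d (∑ j, (d j : ℤ)) (k + 1)).prod
      (isGradedFree_dual_extGr (K := K) (σ := σ) e (∑ j, (d j : ℤ)) (k + 2))).reindex
      (powersetCardEquivLink n k)
    refine Eq.mp (congrArg (IsGradedFree (linkGr K σ d e (k + 1))) (funext fun S => ?_)) h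
    rcases S with S | S <;> rfl

theorem linkD_mem_linkGr {f g : Fin n → MvPolynomial σ K} {d e : Fin n → ℕ}
    (hf : ∀ i, (f i).IsHomogeneous (d i)) (hg : ∀ i, (g i).IsHomogeneous (e i))
    {φ : (Fin n → MvPolynomial σ K) →ₗ[MvPolynomial σ K] (Fin n → MvPolynomial σ K)}
    (hφ : IsComparison f g d e φ) (k : ℕ) (m : ℤ) (x : linkTerm K σ n k)
    (hx : x ∈ linkGr K σ d e k m) : linkD f g φ k x ∈ linkGr K σ d e (k + 1) m := by
  match k with
  | 0 =>
    exact ⟨dualMap_mem_dualGr (fun m v hv => map_mem_extGr hφ.graded 1 m hv) hx,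
      AddSubgroup.neg_mem _ (dualMap_mem_dualGr (fun m v hv => koszulD_mem_extGr hg 1 m hv) hx)⟩
  | k + 1 =>
    exact ⟨AddSubgroup.add_mem _ (dualMap_mem_dualGr (fun m v hv => koszulD_mem_extGr hf (k + 1) m hv) hx.1)
        (dualMap_mem_dualGr (fun m v hv => map_mem_extGr hφ.graded (k + 2) m hv) hx.2),
      AddSubgroup.neg_mem _ (dualMap_mem_dualGr (fun m v hv => koszulD_mem_extGr hg (k + 2) m hv) hx.2)⟩

/-- Since `G_(n+1)^∨ = 0`, the last term is `F_n^∨`, of rank one; the augmentation evaluates a form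
on `topVec` modulo `I`. -/
theorem exists_augmentation {f g : Fin n → MvPolynomial σ K} {d e : Fin n → ℕ} (hn : 2 ≤ n)
    (hf : RingTheory.Sequence.IsWeaklyRegular (MvPolynomial σ K) (List.ofFn f))
    {φ : (Fin n → MvPolynomial σ K) →ₗ[MvPolynomial σ K] (Fin n → MvPolynomial σ K)}
    (hφ : formOf g ∘ₗ φ = formOf f) {I : Ideal (MvPolynomial σ K)}
    (hI : I = (Ideal.span (Set.range f)).colon (Ideal.span (Set.range g))) :
    ∃ ε : linkTerm K σ n n →ₗ[MvPolynomial σ K] MvPolynomial σ K ⧸ I,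
      Function.Surjective ε ∧ LinearMap.ker ε = incoming (linkD f g φ) n ∧
      ∀ (m : ℤ), ∀ x ∈ linkGr K σ d e n m, ∃ p ∈ polyGr K σ m, ε x = Ideal.Quotient.mk I p := by
  -- With `n = k + 2` the last differential starts at index `k + 1`, in the successor case of
  -- `coneD`.
  obtain ⟨k, rfl⟩ : ∃ k, n = k + 2 := ⟨n - 2, by omega⟩
  obtain ⟨ν, hν1, hν⟩ := exists_topDual (MvPolynomial σ K) (k + 2)
  let ev : Module.Dual (MvPolynomial σ K)
      (⋀[MvPolynomial σ K]^(k + 2) (Fin (k + 2) → MvPolynomial σ K)) × Module.Dual (MvPolynomial σ K)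
      (⋀[MvPolynomial σ K]^(k + 3) (Fin (k + 2) → MvPolynomial σ K)) →ₗ[MvPolynomial σ K]
      MvPolynomial σ K ⧸ I :=
    (Submodule.mkQ I) ∘ₗ (Module.Dual.eval (MvPolynomial σ K) _ (topVec (MvPolynomial σ K) (k + 2)))
      ∘ₗ LinearMap.fst _ _ _
  have hev : ∀ a, ev a = Ideal.Quotient.mk I (a.1 (topVec (MvPolynomial σ K) (k + 2))) :=
    fun _ => rfl
  refine ⟨ev, fun r => ?_, ?_, fun m x hx => ?_⟩
  · obtain ⟨r, rfl⟩ := Ideal.Quotient.mk_surjective r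
    refine ⟨((r • ν, 0) : _ × _), (hev _).trans ?_⟩
    simp [hν1]
  · refine Submodule.ext fun a => ?_
    have : Subsingleton (⋀[MvPolynomial σ K]^(k + 3) (Fin (k + 2) → MvPolynomial σ K)) :=
      subsingleton_exteriorPower (by omega)
    have hdual : ∀ b b' : Module.Dual (MvPolynomial σ K)
        (⋀[MvPolynomial σ K]^(k + 3) (Fin (k + 2) → MvPolynomial σ K)), b = b' := fun b b' =>
      LinearMap.ext fun y => by rw [Subsingleton.elim y 0, map_zero, map_zero]
    refine Iff.trans (Iff.trans (b := a.1 (topVec (MvPolynomial σ K) (k + 2)) ∈ I)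
      Ideal.Quotient.eq_zero_iff_mem ?_) exists_coneD_succ_eq_iff.symm
    rw [hI]
    constructor
    · intro ha
      obtain ⟨a', b, hab⟩ := exists_smul_eq_of_mem_colon hf hφ (m := k + 1) rfl ha ν
      exact ⟨a', b, hab.symm.trans (dual_top_eq a.1 hν).symm, hdual _ _⟩
    · rintro ⟨c, b, h1, -⟩
      rw [← h1]
      exact apply_mem_colon hφ rfl c b _
  · refine ⟨_, ?_, hev x⟩
    -- `topVec` has degree `∑ d_j`, which the shift by `-α_X` cancels.
    have := hx.1 _ _ (topVec_mem_extGr (K := K) (σ := σ) d)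
    rwa [add_neg_cancel_left] at this

theorem isMinimalGradedFreeResolution {f g : Fin n → MvPolynomial σ K} {d e : Fin n → ℕ}
    (hn : 2 ≤ n) (hf : IsCompleteIntersection f d) (hg : IsCompleteIntersection g e)
    (hfg : Ideal.span (Set.range f) ≤ irrelevant K σ * Ideal.span (Set.range g))
    {φ : (Fin n → MvPolynomial σ K) →ₗ[MvPolynomial σ K] (Fin n → MvPolynomial σ K)}
    (hφ : IsComparison f g d e φ) {I : Ideal (MvPolynomial σ K)}
    (hI : I = (Ideal.span (Set.range f)).colon (Ideal.span (Set.range g))) :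
    IsMinimalGradedFreeResolution I n (linkTerm K σ n) (linkGr K σ d e) (linkD f g φ) := by
  have hf' := hf.regular.toIsWeaklyRegular
  have hg' := hg.regular.toIsWeaklyRegular
  have hgtop : Ideal.span (Set.range g) ≠ ⊤ := by
    have := hg.regular.top_ne_smul.symm
    simpa [Ideal.ofList, List.mem_ofFn', Set.range] using this
  have hgm : ∀ j, g j ∈ irrelevant K σ := fun j =>
    mem_irrelevant_of_ne_top (hg.homogeneous j) hgtop (Ideal.subset_span (Set.mem_range_self j))
  have hfm : ∀ j, f j ∈ irrelevant K σ * Ideal.span (Set.range g) := fun j =>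
    hfg (Ideal.subset_span (Set.mem_range_self j))
  refine ⟨fun k _ => ?_, fun k _ => linkD_mem_linkGr hf.homogeneous hg.homogeneous hφ k, ?_,
    exists_augmentation hn hf' hφ.comm hI, fun k _ => ?_⟩
  · exact ⟨_, _, (isGradedFree_linkGr d e k).reindex (Finite.equivFin _).symm⟩
  · refine ker_coneD_eq_incoming _ _ _ (koszulD_koszulD f) (koszulD_koszulD g)
      (koszulD_map hφ.comm) hn ?_ (eq_zero_of_koszulD_dualMap_eq_zero hf' (by omega))
      (exists_koszulD_dualMap_eq hf') (exists_koszulD_dualMap_eq hg')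
      (exists_koszulD_dualMap_eq_of_map hf' hφ.comm)
    rw [map_zero_eq_id]
    exact Function.bijective_id
  · exact range_coneD_le (koszulD_mem fun j => Ideal.mul_le_left (hfm j)) (koszulD_mem hgm)
      (map_mem_ideal_smul_top_of_forall (apply_mem_of_formOf_comp_eq hg' hφ.comm
        (Ideal.span_le.2 (Set.range_subset_iff.2 hgm)) hfm)) k

end Assembly

end LinkageCone

theorem lemma2p1 {K : Type*} [Field K] {n : ℕ} (hn : 3 ≤ n)
    (d e : Fin n → ℕ) (hd : ∀ i, 1 < d i)
    (f g : Fin n → MvPolynomial (Fin (n + 1)) K)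
    (hf : LinkageCone.IsCompleteIntersection f d)
    (hg : LinkageCone.IsCompleteIntersection g e)
    (IX IY IZ : Ideal (MvPolynomial (Fin (n + 1)) K))
    (hX : IX = Ideal.span (Set.range f))
    (hZ : IZ = Ideal.span (Set.range g))
    (hY : IY = IX.colon IZ)
    (hXZ : IX ≤ LinkageCone.irrelevant K (Fin (n + 1)) * IZ) :
    (∃ φ, LinkageCone.IsComparison f g d e φ) ∧
    (∀ φ, LinkageCone.IsComparison f g d e φ →
      LinkageCone.IsMinimalGradedFreeResolution IY n
        (LinkageCone.linkTerm K (Fin (n + 1)) n)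
        (LinkageCone.linkGr K (Fin (n + 1)) d e)
        (LinkageCone.linkD f g φ)) ∧
    (∀ k ≤ n, LinkageCone.IsGradedFree (K := K) (σ := Fin (n + 1))
        (LinkageCone.linkGr K (Fin (n + 1)) d e k)
        (LinkageCone.linkShifts d e (∑ j, (d j : ℤ)) k)) := by
  subst hX hZ
  refine ⟨LinkageCone.exists_isComparison hf.homogeneous hg.homogeneous fun j =>
    Ideal.mul_le_right (hXZ (Ideal.subset_span (Set.mem_range_self j))), fun φ hφ => ?_,
    fun k _ => LinkageCone.isGradedFree_linkGr d e k⟩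
  exact LinkageCone.isMinimalGradedFreeResolution (by omega) hf hg hXZ hφ hY
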